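/- Let $d\ge 1$ and equip $\mathbb R^d$ with the supremum norm $\|\cdot\|$. Let $D=D([0,\infty),\mathbb R^d)$ be the space of càdlàg functions; for $x\in D$ let $x(t-)$ be the left limit at $t$ (with $x(0-)=x(0)$) and $\mathrm{disc}(x)$ the set of discontinuity points of $x$. For $x\in D$ and $t\ge 0$ put $$\eta_x(t)=\sup\{s<t: x(s)\ne x(t)\}\in[0,\infty),\qquad \theta_x(t)=\inf\{s\ge t: x(s)\ne x(t-)\}\in[0,\infty],$$ with $\sup\emptyset=0$ and $\inf\emptyset=\infty$, so that $\eta_x(t)\le t\le\theta_x(t)$. Define $f:D\to D$ by $$f(x)(t)=x(\eta_x(t))+\frac{x(\theta_x(t))-x(\eta_x(t))}{\theta_x(t)-\eta_x(t)}\,(t-\eta_x(t)),$$ where $f(x)(t)=x(t)$ if $\eta_x(t)=\theta_x(t)=t$ or if $\theta_x(t)=\infty$. Thus $f$ replaces each "stair" of $x$ (a maximal interval of constancy ending at a jump) by the segment joining its ends. For $T>0$, the $J_1$ distance of $x,y$ on $[0,T]$ is $\inf_\lambda \max\{\sup_{t\le T}\|x(\lambda(t))-y(t)\|,\ \sup_{t\le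 T}|\lambda(t)-t|\}$ over increasing homeomorphisms $\lambda$ of $[0,T]$. The completed graph of $x$ on $[0,T]$ is $\Gamma_x=\{(z,t): 0\le t\le T,\ z\in[x(t-),x(t)]\}$, ordered by $(z_1,t_1)\le(z_2,t_2)$ iff $t_1<t_2$, or $t_1=t_2$ and $\|x(t_1-)-z_1\|\le\|x(t_1-)-z_2\|$; a parametric representation of $x$ is a continuous nondecreasing map of $[0,1]$ onto $\Gamma_x$; the strong $M_1$ ($SM_1$) distance of $x,y$ on $[0,T]$ is the infimum over parametric representations $\gamma$ of $x$ and $\gamma'$ of $y$ of $\sup_{s\in[0,1]}\|\gamma(s)-\gamma'(s)\|$ (maximum norm on $\mathbb R^d\times[0,T]$). Convergence $x_n\to x$ in $J_1$ (resp. $SM_1$) on $D$ means that the $J_1$ (resp. $SM_1$) distance of $x_n$ and $x$ on $[0,T]$ tends to $0$ for every $T>0$ with $T\notin\mathrm{disc}(x)$. **Theorem.** Let $x,x_n\in D$, where $x$ is not constant on any half-line $[c,\infty)$ (equivalently, $\theta_x(t)<\infty$ for all $t\ge0$). Assume that $x_n\to x$ in the $J_1$ topology and that for every $t\ge 0$ such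 that $\eta_x(t)<t<\theta_x(t)$, $x$ is constant on $(\eta_x(t),\theta_x(t))$ and $\theta_x(t)\in\mathrm{disc}(x)$, there is a sequence $t_n\to t$ in $[0,\infty)$ with (i) $\eta_{x_n}(t_n)\to\eta_x(t)$, (ii) $\theta_{x_n}(t_n)\to\theta_x(t)$, (iii) $\|x_n(\theta_{x_n}(t_n))-x_n(\theta_{x_n}(t_n)-)\|\to\|x(\theta_x(t))-x(\theta_x(t)-)\|$. Then $f(x_n)\to f(x)$ in the $SM_1$ topology. -/

import Mathlib

open Set Filter Topology
open scoped NNReal ENNReal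

/-- `ℝ^d` with the supremum norm (the norm of a finite product in Mathlib). -/
abbrev Vec (d : ℕ) : Type := Fin d → ℝ

/-- A function on `[0, ∞)` is càdlàg: right-continuous, with left limits
(the requirement on left limits is void at `0`). -/
structure IsCadlag {d : ℕ} (x : ℝ≥0 → Vec d) : Prop where
  right_cont : ∀ t, ContinuousWithinAt x (Ici t) t
  left_lim : ∀ t, ∃ l, Tendsto x (𝓝[<] t) (𝓝 l)

/-- The space `D([0, ∞), ℝ^d)` of càdlàg functions. -/
structure Cadlag (d : ℕ) where
  toFun : ℝ≥0 → Vec d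
  isCadlag : IsCadlag toFun

instance (d : ℕ) : CoeFun (Cadlag d) (fun _ => ℝ≥0 → Vec d) := ⟨Cadlag.toFun⟩

/-- The left limit `x(t-)`, with the convention `x(0-) = x(0)`. -/
noncomputable def leftVal {d : ℕ} (x : ℝ≥0 → Vec d) (t : ℝ≥0) : Vec d := Function.leftLim x t

/-- The set of discontinuity points of `x`. -/
def disc {d : ℕ} (x : ℝ≥0 → Vec d) : Set ℝ≥0 := {t | ¬ ContinuousAt x t}

/-- `η_x(t) = sup {s < t : x(s) ≠ x(t)}`, a supremum in `[0, ∞)` (so `sup ∅ = 0`). -/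
noncomputable def eta {d : ℕ} (x : ℝ≥0 → Vec d) (t : ℝ≥0) : ℝ≥0 :=
  sSup {s | s < t ∧ x s ≠ x t}

/-- `θ_x(t) = inf {s ≥ t : x(s) ≠ x(t-)}`, an infimum in `[0, ∞]` (so `inf ∅ = ∞`). -/
noncomputable def theta {d : ℕ} (x : ℝ≥0 → Vec d) (t : ℝ≥0) : ℝ≥0∞ :=
  sInf {u | ∃ s : ℝ≥0, t ≤ s ∧ x s ≠ leftVal x t ∧ u = (s : ℝ≥0∞)}

/-- The time `θ_x(t)` as an element of `[0, ∞)`; meaningful when `θ_x(t) < ∞`. -/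
noncomputable def thetaFin {d : ℕ} (x : ℝ≥0 → Vec d) (t : ℝ≥0) : ℝ≥0 := (theta x t).toNNReal

/-- The formula for `f(x)(t)`: linear interpolation between `(η_x(t), x(η_x(t)))` and
`(θ_x(t), x(θ_x(t)))`; a final constant piece (`θ_x(t) = ∞`) is no stair and is left unchanged.
If `η_x(t) = θ_x(t)`, both equal `t`, and the value is `x(t)`. -/
noncomputable def stairFun {d : ℕ} (x : ℝ≥0 → Vec d) (t : ℝ≥0) : Vec d :=
  open Classical in
  if theta x t = ⊤ then x t
  else x (eta x t) +
    (((t : ℝ) - eta x t) / ((thetaFin x t : ℝ) - eta x t)) • (x (thetaFin x t) - x (eta x t))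

section Aux

variable {d : ℕ} {x : ℝ≥0 → Vec d}

theorem eta_le (x : ℝ≥0 → Vec d) (t : ℝ≥0) : eta x t ≤ t :=
  csSup_le' fun _ hs => hs.1.le

theorem le_theta (x : ℝ≥0 → Vec d) (t : ℝ≥0) : (t : ℝ≥0∞) ≤ theta x t := by
  refine le_sInf ?_
  rintro _ ⟨s, hs, -, rfl⟩
  exact_mod_cast hs

theorem eq_of_eta_lt {s t : ℝ≥0} (h : eta x t < s) (hst : s ≤ t) : x s = x t := by
  by_contra hne
  have hlt : s < t := lt_of_le_of_ne hst (by rintro rfl; exact hne rfl)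
  exact absurd (le_csSup ⟨t, fun r hr => hr.1.le⟩ (show s ∈ {s | s < t ∧ x s ≠ x t} from
    ⟨hlt, hne⟩)) (not_le.2 h)

theorem eq_leftVal_of_lt_theta {s t : ℝ≥0} (hts : t ≤ s) (h : (s : ℝ≥0∞) < theta x t) :
    x s = leftVal x t := by
  by_contra hne
  exact absurd (sInf_le (show (s : ℝ≥0∞) ∈ {u | ∃ s : ℝ≥0, t ≤ s ∧ x s ≠ leftVal x t ∧
    u = (s : ℝ≥0∞)} from ⟨s, hts, hne, rfl⟩)) (not_le.2 h)

theorem eq_of_lt_theta {s t : ℝ≥0} (hts : t ≤ s) (h : (s : ℝ≥0∞) < theta x t) : x s = x t := by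
  rw [eq_leftVal_of_lt_theta hts h]
  exact (eq_leftVal_of_lt_theta le_rfl (lt_of_le_of_lt (by exact_mod_cast hts) h)).symm

/-- `x` is constant on the set `s`. -/
def ConstOn {d : ℕ} (x : ℝ≥0 → Vec d) (s : Set ℝ≥0) : Prop := ∀ u ∈ s, ∀ v ∈ s, x u = x v

theorem leftVal_of_const {a b t : ℝ≥0} (h : ConstOn x (Ioo a b)) (ht : t ∈ Ioo a b) :
    leftVal x t = x t := by
  refine ContinuousWithinAt.leftLim_eq (ContinuousAt.continuousWithinAt ?_)
  refine (continuousAt_const (y := x t)).congr ?_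
  filter_upwards [Ioo_mem_nhds ht.1 ht.2] with s hs using h t ht s hs

theorem eta_eq_of_const {a b s t : ℝ≥0} (h : ConstOn x (Ioo a b)) (hs : s ∈ Ioo a b)
    (ht : t ∈ Ioo a b) : eta x s = eta x t := by
  have key : ∀ s ∈ Ioo a b, {r | r < s ∧ x r ≠ x s} = {r | r ≤ a ∧ x r ≠ x s} := by
    intro s hs
    ext r
    constructor
    · rintro ⟨h1, h2⟩
      refine ⟨?_, h2⟩
      by_contra hra
      exact h2 (h r ⟨not_le.1 hra, h1.trans hs.2⟩ s hs)
    · rintro ⟨h1, h2⟩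
      exact ⟨h1.trans_lt hs.1, h2⟩
  unfold eta
  rw [key s hs, key t ht, h s hs t ht]

theorem theta_eq_of_const {a b s t : ℝ≥0} (h : ConstOn x (Ioo a b)) (hs : s ∈ Ioo a b)
    (ht : t ∈ Ioo a b) : theta x s = theta x t := by
  have key : ∀ s ∈ Ioo a b, {u | ∃ r : ℝ≥0, s ≤ r ∧ x r ≠ leftVal x s ∧ u = (r : ℝ≥0∞)} =
      {u | ∃ r : ℝ≥0, b ≤ r ∧ x r ≠ x s ∧ u = (r : ℝ≥0∞)} := by
    intro s hs
    rw [leftVal_of_const h hs]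
    ext u
    constructor
    · rintro ⟨r, h1, h2, h3⟩
      refine ⟨r, ?_, h2, h3⟩
      by_contra hra
      exact h2 (h r ⟨hs.1.trans_le h1, not_le.1 hra⟩ s hs)
    · rintro ⟨r, h1, h2, h3⟩
      exact ⟨r, hs.2.le.trans h1, h2, h3⟩
  unfold theta
  rw [key s hs, key t ht, h s hs t ht]

/-- On an interval where `x` is constant, `stairFun x` agrees with a continuous function. -/
theorem stairFun_eq_affine {a b : ℝ≥0} (h : ConstOn x (Ioo a b)) {t₀ : ℝ≥0}
    (h₀ : t₀ ∈ Ioo a b) : ∃ g : ℝ≥0 → Vec d, Continuous g ∧ (∀ t ∈ Ioo a b, stairFun x t = g t) ∧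
      (g (eta x t₀) = x (eta x t₀) ∨ ∀ t, g t = x t₀) := by
  classical
  by_cases hθ : theta x t₀ = ⊤
  · refine ⟨fun _ => x t₀, continuous_const, fun t ht => ?_, Or.inr fun _ => rfl⟩
    have : theta x t = ⊤ := (theta_eq_of_const h ht h₀).trans hθ
    simp only [stairFun, this, if_true]
    exact h t ht t₀ h₀
  · refine ⟨fun t => x (eta x t₀) +
      (((t : ℝ) - eta x t₀) / ((thetaFin x t₀ : ℝ) - eta x t₀)) •
        (x (thetaFin x t₀) - x (eta x t₀)), by fun_prop, fun t ht => ?_, Or.inl (by simp)⟩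
    simp only [stairFun, thetaFin, theta_eq_of_const h ht h₀, eta_eq_of_const h ht h₀, if_neg hθ]

theorem stairFun_of_eta_eq {t : ℝ≥0} (h : eta x t = t) : stairFun x t = x t := by
  classical
  unfold stairFun
  split_ifs with hθ
  · rfl
  · simp [h]

theorem stairFun_of_theta_eq {t : ℝ≥0} (h : theta x t = t) : stairFun x t = x t := by
  classical
  rcases eq_or_lt_of_le (eta_le x t) with h' | h'
  · exact stairFun_of_eta_eq h'
  have h2 : ((t : ℝ) - eta x t) ≠ 0 := by
    have : (eta x t : ℝ) < t := by exact_mod_cast h'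
    linarith
  simp [stairFun, thetaFin, h, div_self h2]

theorem stairFun_mem_ball {t : ℝ≥0} {c : Vec d} {ε : ℝ} (hθ : theta x t ≠ ⊤)
    (h1 : x (eta x t) ∈ Metric.ball c ε) (h2 : x (thetaFin x t) ∈ Metric.ball c ε) :
    stairFun x t ∈ Metric.ball c ε := by
  classical
  rw [stairFun, if_neg hθ]
  have ha : (eta x t : ℝ) ≤ t := by exact_mod_cast eta_le x t
  have hb : (t : ℝ) ≤ thetaFin x t := by
    have h3 := le_theta x t
    rw [← ENNReal.coe_toNNReal hθ] at h3
    exact_mod_cast h3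
  refine (convex_ball c ε).add_smul_sub_mem h1 h2 ⟨?_, ?_⟩
  · exact div_nonneg (by linarith) (by linarith)
  · exact div_le_one_of_le₀ (by linarith) (by linarith)

theorem isCadlag_stairFun (hx : IsCadlag x) : IsCadlag (stairFun x) := by
  constructor
  · intro t₀
    rw [← continuousWithinAt_Ioi_iff_Ici]
    by_cases hc : ∃ b > t₀, ConstOn x (Ioo t₀ b)
    · obtain ⟨b, hb, hc⟩ := hc
      obtain ⟨t₁, ht₁⟩ := exists_between hb
      have hval : ∀ t ∈ Ioo t₀ b, x t = x t₀ := by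
        intro t ht
        have h1 : Tendsto x (𝓝[>] t₀) (𝓝 (x t₀)) :=
          (hx.right_cont t₀).mono Ioi_subset_Ici_self
        refine tendsto_nhds_unique (tendsto_const_nhds.congr' ?_) h1
        filter_upwards [Ioo_mem_nhdsGT hb] with s hs using hc t ht s hs
      have hle : eta x t₁ ≤ t₀ := by
        by_contra hlt
        push Not at hlt
        obtain ⟨s, hs1, hs2⟩ := exists_lt_of_lt_csSup'
          (show t₀ < sSup {s | s < t₁ ∧ x s ≠ x t₁} from hlt)
        exact hs1.2 (hc s ⟨hs2, hs1.1.trans ht₁.2⟩ t₁ ht₁)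
      rcases hle.lt_or_eq with hlt | heq
      · have hc' : ConstOn x (Ioo (eta x t₁) b) := by
          have aux : ∀ u ∈ Ioo (eta x t₁) b, x u = x t₁ := by
            intro u hu
            rcases le_total u t₁ with h | h
            · exact eq_of_eta_lt hu.1 h
            · exact hc u ⟨ht₁.1.trans_le h, hu.2⟩ t₁ ht₁
          intro u hu v hv
          rw [aux u hu, aux v hv]
        obtain ⟨g, hg, hfg, -⟩ := stairFun_eq_affine hc' (t₀ := t₀) ⟨hlt, hb⟩
        refine ContinuousAt.continuousWithinAt (hg.continuousAt.congr ?_)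
        filter_upwards [Ioo_mem_nhds hlt hb] with s hs using (hfg s hs).symm
      · obtain ⟨g, hg, hfg, hor⟩ := stairFun_eq_affine hc ht₁
        have hg0 : g t₀ = x t₀ := by
          rcases hor with h | h
          · rwa [heq] at h
          · rw [h, hval t₁ ht₁]
        have hf0 : stairFun x t₀ = x t₀ := by
          refine stairFun_of_eta_eq ?_
          refine le_antisymm (eta_le x t₀) ?_
          conv_lhs => rw [← heq]
          refine csSup_le' ?_
          rintro s ⟨hs1, hs2⟩
          by_contra hlt
          push Not at hlt
          rcases le_total s t₀ with h | h
          · exact hs2 (by rw [eq_of_eta_lt hlt h, hval t₁ ht₁])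
          · rcases h.eq_or_lt with h | h
            · subst h; exact hs2 (hval t₁ ht₁).symm
            · exact hs2 (hc s ⟨h, hs1.trans ht₁.2⟩ t₁ ht₁)
        have h2 : Tendsto g (𝓝[>] t₀) (𝓝 (stairFun x t₀)) := by
          rw [hf0, ← hg0]
          exact hg.continuousAt.continuousWithinAt
        refine Tendsto.congr' ?_ h2
        filter_upwards [Ioo_mem_nhdsGT hb] with s hs using (hfg s hs).symm
    · push Not at hc
      have hf0 : stairFun x t₀ = x t₀ := by
        refine stairFun_of_theta_eq (le_antisymm ?_ (le_theta x t₀))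
        by_contra hlt
        push Not at hlt
        obtain ⟨b, hb1, hb2⟩ := ENNReal.lt_iff_exists_nnreal_btwn.1 hlt
        refine hc b (by exact_mod_cast hb1) ?_
        intro u hu v hv
        rw [eq_of_lt_theta hu.1.le (lt_trans (by exact_mod_cast hu.2) hb2),
          eq_of_lt_theta hv.1.le (lt_trans (by exact_mod_cast hv.2) hb2)]
      rw [ContinuousWithinAt, hf0, Metric.tendsto_nhds]
      intro ε hε
      have h1 : ∀ᶠ s in 𝓝[≥] t₀, x s ∈ Metric.ball (x t₀) ε :=
        (hx.right_cont t₀) (Metric.ball_mem_nhds _ hε)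
      obtain ⟨b, hb, hball⟩ := (mem_nhdsGE_iff_exists_Ico_subset).1 h1
      have h2 := hc b hb
      simp only [ConstOn, not_forall] at h2
      obtain ⟨p, hp, q, hq, hpq⟩ := h2
      have hm : t₀ < min p q := lt_min hp.1 hq.1
      filter_upwards [Ioo_mem_nhdsGT hm] with t ht
      have htp : t < p := ht.2.trans_le (min_le_left _ _)
      have htq : t < q := ht.2.trans_le (min_le_right _ _)
      have hη : t₀ ≤ eta x t := by
        by_contra hlt
        push Not at hlt
        refine hc t ht.1 fun u hu v hv => ?_
        rw [eq_of_eta_lt (hlt.trans hu.1) hu.2.le, eq_of_eta_lt (hlt.trans hv.1) hv.2.le]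
      have hθ : theta x t < b := by
        by_contra hge
        push Not at hge
        refine hpq ?_
        rw [eq_of_lt_theta htp.le (lt_of_lt_of_le (by exact_mod_cast hp.2) hge),
          eq_of_lt_theta htq.le (lt_of_lt_of_le (by exact_mod_cast hq.2) hge)]
      have hθ' : theta x t ≠ ⊤ := ne_top_of_lt hθ
      have hco : (thetaFin x t : ℝ≥0∞) = theta x t := ENNReal.coe_toNNReal hθ'
      have hle := le_theta x t
      rw [← hco] at hθ hle
      exact stairFun_mem_ball hθ'
        (hball ⟨hη, (eta_le x t).trans_lt (htp.trans hp.2)⟩)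
        (hball ⟨ht.1.le.trans (by exact_mod_cast hle), by exact_mod_cast hθ⟩)
  · intro t₀
    by_cases h0 : t₀ = 0
    · subst h0
      exact ⟨0, by simp⟩
    have hpos : 0 < t₀ := pos_iff_ne_zero.2 h0
    by_cases hc : ∃ a < t₀, ConstOn x (Ioo a t₀)
    · obtain ⟨a, ha, hc⟩ := hc
      obtain ⟨t₁, ht₁⟩ := exists_between ha
      obtain ⟨g, hg, hfg, -⟩ := stairFun_eq_affine hc ht₁
      refine ⟨g t₀, Tendsto.congr' ?_ (hg.continuousAt.continuousWithinAt (s := Iio t₀))⟩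
      filter_upwards [Ioo_mem_nhdsLT ha] with s hs using (hfg s hs).symm
    · push Not at hc
      obtain ⟨l, hl⟩ := hx.left_lim t₀
      refine ⟨l, ?_⟩
      rw [Metric.tendsto_nhds]
      intro ε hε
      have h1 : ∀ᶠ s in 𝓝[<] t₀, x s ∈ Metric.ball l ε := hl (Metric.ball_mem_nhds _ hε)
      obtain ⟨a, ha, hball⟩ := (mem_nhdsLT_iff_exists_Ioo_subset' hpos).1 h1
      have h2 := hc a ha
      simp only [ConstOn, not_forall] at h2
      obtain ⟨p, hp, q, hq, hpq⟩ := h2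
      have hm : max p q < t₀ := max_lt hp.2 hq.2
      filter_upwards [Ioo_mem_nhdsLT hm] with t ht
      have hpt : p < t := (le_max_left _ _).trans_lt ht.1
      have hqt : q < t := (le_max_right _ _).trans_lt ht.1
      have hη : a < eta x t := by
        by_contra hge
        push Not at hge
        exact hpq (by rw [eq_of_eta_lt (hge.trans_lt hp.1) hpt.le,
          eq_of_eta_lt (hge.trans_lt hq.1) hqt.le])
      have hθ : theta x t < t₀ := by
        by_contra hge
        push Not at hge
        refine hc t ht.2 fun u hu v hv => ?_
        rw [eq_of_lt_theta hu.1.le (lt_of_lt_of_le (by exact_mod_cast hu.2) hge),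
          eq_of_lt_theta hv.1.le (lt_of_lt_of_le (by exact_mod_cast hv.2) hge)]
      have hθ' : theta x t ≠ ⊤ := ne_top_of_lt hθ
      have hco : (thetaFin x t : ℝ≥0∞) = theta x t := ENNReal.coe_toNNReal hθ'
      have hle := le_theta x t
      rw [← hco] at hθ hle
      exact stairFun_mem_ball hθ'
        (hball ⟨hη, (eta_le x t).trans_lt ht.2⟩)
        (hball ⟨(hp.1.trans hpt).trans_le (by exact_mod_cast hle), by exact_mod_cast hθ⟩)

end Aux

/-- The mapping `f : D([0, ∞), ℝ^d) → D([0, ∞), ℝ^d)` which replaces every stair by the segment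
joining its ends. -/
noncomputable def stairMap {d : ℕ} (x : Cadlag d) : Cadlag d :=
  ⟨stairFun x, isCadlag_stairFun x.isCadlag⟩

/-- `t` lies in the interior of a stair of `x`: `η_x(t) < t < θ_x(t) < ∞`, `x` is constant on
`(η_x(t), θ_x(t))`, and `θ_x(t)` is a discontinuity point of `x`. -/
def InStair {d : ℕ} (x : Cadlag d) (t : ℝ≥0) : Prop :=
  eta x t < t ∧ (t : ℝ≥0∞) < theta x t ∧ theta x t < ⊤ ∧
    ConstOn x (Ioo (eta x t) (thetaFin x t)) ∧ thetaFin x t ∈ disc x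

/-- The Skorohod `J₁` distance of the restrictions of `x` and `y` to `[0, T]`: the infimum, over
the increasing homeomorphisms `lam` of `[0, T]`, of the larger one of
`sup_t ‖x(lam t) - y(t)‖` and `sup_t |lam t - t|`. -/
noncomputable def distJ1 {d : ℕ} (T : ℝ≥0) (x y : Cadlag d) : ℝ≥0∞ :=
  ⨅ lam : Icc (0 : ℝ≥0) T ≃o Icc (0 : ℝ≥0) T,
    max (⨆ t : Icc (0 : ℝ≥0) T, edist (x (lam t)) (y t))
      (⨆ t : Icc (0 : ℝ≥0) T, edist (lam t) t)

/-- Convergence in the `J₁` topology on `D([0, ∞), ℝ^d)`: convergence of the restrictions to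
`[0, T]` for all continuity points `T > 0` of the limit. -/
def TendstoJ1 {d : ℕ} (xn : ℕ → Cadlag d) (x : Cadlag d) : Prop :=
  ∀ T : ℝ≥0, 0 < T → T ∉ disc x → Tendsto (fun n => distJ1 T (xn n) x) atTop (𝓝 0)

/-- The completed graph of the restriction of `x` to `[0, T]`. -/
def completedGraph {d : ℕ} (T : ℝ≥0) (x : Cadlag d) : Set (Vec d × ℝ≥0) :=
  {p | p.2 ≤ T ∧ p.1 ∈ segment ℝ (leftVal x p.2) (x p.2)}

/-- The order on a completed graph: first by time, then by the distance to `x(t-)`. -/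
def graphLE {d : ℕ} (x : Cadlag d) (p q : Vec d × ℝ≥0) : Prop :=
  p.2 < q.2 ∨ (p.2 = q.2 ∧ ‖leftVal x p.2 - p.1‖ ≤ ‖leftVal x p.2 - q.1‖)

/-- A (strong) parametric representation of the restriction of `x` to `[0, T]`: a continuous map
of `[0, 1]` onto the completed graph, nondecreasing for the order of the completed graph. -/
structure ParamRep {d : ℕ} (T : ℝ≥0) (x : Cadlag d) where
  toFun : unitInterval → Vec d × ℝ≥0
  continuous_toFun : Continuous toFun
  range_eq : range toFun = completedGraph T x
  mono : ∀ s s' : unitInterval, s ≤ s' → graphLE x (toFun s) (toFun s')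

/-- The strong `M₁` distance of the restrictions of `x` and `y` to `[0, T]`: the infimum, over
the parametric representations, of their uniform distance (with the maximum norm on
`ℝ^d × [0, T]`). -/
noncomputable def distSM1 {d : ℕ} (T : ℝ≥0) (x y : Cadlag d) : ℝ≥0∞ :=
  ⨅ (a : ParamRep T x) (b : ParamRep T y), ⨆ s : unitInterval, edist (a.toFun s) (b.toFun s)

/-- Convergence in the strong `M₁` topology on `D([0, ∞), ℝ^d)`: convergence of the restrictions
to `[0, T]` for all continuity points `T > 0` of the limit. -/
def TendstoSM1 {d : ℕ} (xn : ℕ → Cadlag d) (x : Cadlag d) : Prop :=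
  ∀ T : ℝ≥0, 0 < T → T ∉ disc x → Tendsto (fun n => distSM1 T (xn n) x) atTop (𝓝 0)

/-! Write `y = f(x)` and `yₙ = f(xₙ)`. By `J₁` convergence, time changes `lam` close to the identity
make `xₙ ∘ lam` uniformly close to `x` on bounded intervals. The proof is local: every time `t₀` has
arbitrarily short windows on which the completed graphs of `y` and, for large `n`, of `yₙ` run
monotonically along one common segment from `l` to `r`, up to `ε` (`exists_tracksSegment`).

If `x` is continuous at `t₀`, or jumps there after an interval of constancy, then `yₙ(s) → y(t₀)`
jointly as `n → ∞`, `s → t₀`, and the segment is the point `y(t₀)`. Inside a stair, (i)-(iii)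
provide stairs of `xₙ` converging to it. Condition (iii) forces their ends to be exactly `lam θ`,
because near `θ` no other jump of `xₙ` has comparable size (`eventually_eq_of_jump`); so the height
reached also converges. Outside the stairs `y = x`, and `yₙ(s)` lies on the segment from `xₙ(s)` to
`xₙ(θₙ(s))`, whose far end has to be controlled (`eventually_stairFun_near`).

If `x` jumps at `t₀` without being constant just before, then `y` jumps there too. Here `xₙ` may or
may not have a short stair ending at `lam t₀`: `yₙ` either climbs a steep affine piece or jumps.
Both follow the segment from `x(t₀-)` to `x(t₀)`, which is why the limit holds in `SM₁` and not in
`J₁` (`eventually_tracksSegment`).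

Two graphs that track the same segment are synchronized by cutting it into pieces shorter than `ε`:
a piece gives a rectangle of parameter pairs at distance at most `3ε`, and these rectangles are
crossed by a monotone path (`exists_monoJoined`). A supremum argument over `[0, T]` chains the
windows (`eventually_distSM1_le`). -/

/-! ### Left limits and discontinuities of càdlàg functions -/

theorem IsCadlag.tendsto_leftVal {d : ℕ} {z : ℝ≥0 → Vec d} (hz : IsCadlag z) (t : ℝ≥0) :
    Tendsto z (𝓝[<] t) (𝓝 (leftVal z t)) :=
  tendsto_leftLim_of_tendsto (hz.left_lim t)

theorem IsCadlag.exists_near_left {d : ℕ} {z : ℝ≥0 → Vec d} (hz : IsCadlag z) (t : ℝ≥0)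
    {ε : ℝ} (hε : 0 < ε) :
    ∃ δ > (0 : ℝ), ∀ s < t, (t : ℝ) < s + δ → dist (z s) (leftVal z t) < ε := by
  obtain ⟨δ, hδ, h⟩ := Metric.mem_nhdsWithin_iff.1
    (hz.tendsto_leftVal t (Metric.ball_mem_nhds _ hε))
  refine ⟨δ, hδ, fun s hs hts => h ⟨?_, hs⟩⟩
  have : (s : ℝ) < t := hs
  rw [Metric.mem_ball, NNReal.dist_eq, abs_lt]
  constructor <;> linarith

theorem IsCadlag.exists_near_right {d : ℕ} {z : ℝ≥0 → Vec d} (hz : IsCadlag z) (t : ℝ≥0)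
    {ε : ℝ} (hε : 0 < ε) :
    ∃ δ > (0 : ℝ), ∀ s, t ≤ s → (s : ℝ) < t + δ → dist (z s) (z t) < ε := by
  obtain ⟨δ, hδ, h⟩ := Metric.mem_nhdsWithin_iff.1
    (hz.right_cont t (Metric.ball_mem_nhds _ hε))
  refine ⟨δ, hδ, fun s hs hts => h ⟨?_, hs⟩⟩
  have : (t : ℝ) ≤ s := hs
  rw [Metric.mem_ball, NNReal.dist_eq, abs_lt]
  constructor <;> linarith

theorem leftVal_mem_of_isClosed {d : ℕ} {z : ℝ≥0 → Vec d} (hz : IsCadlag z) {a t : ℝ≥0}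
    (hat : a < t) {K : Set (Vec d)} (hK : IsClosed K) (h : ∀ s, a < s → s < t → z s ∈ K) :
    leftVal z t ∈ K := by
  have : (𝓝[<] t).NeBot := nhdsLT_neBot_of_exists_lt ⟨a, hat⟩
  refine hK.mem_of_tendsto (hz.tendsto_leftVal t) ?_
  filter_upwards [Ioo_mem_nhdsLT hat] with s hs using h s hs.1 hs.2

theorem leftVal_eq_of_eqOn {d : ℕ} {z : ℝ≥0 → Vec d} (hz : IsCadlag z) {a t : ℝ≥0}
    (hat : a < t) {c : Vec d} (h : ∀ s, a < s → s < t → z s = c) : leftVal z t = c :=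
  leftVal_mem_of_isClosed hz hat (isClosed_singleton (x := c)) h

theorem leftVal_zero {d : ℕ} (z : ℝ≥0 → Vec d) : leftVal z 0 = z 0 :=
  leftLim_eq_of_isBot fun _ => zero_le

theorem leftVal_eq_iff_continuousAt {d : ℕ} {z : ℝ≥0 → Vec d} (hz : IsCadlag z) {t : ℝ≥0} :
    leftVal z t = z t ↔ ContinuousAt z t := by
  constructor
  · intro h
    refine continuousAt_iff_continuous_left'_right'.2 ⟨?_, ?_⟩
    · have := hz.tendsto_leftVal t
      rwa [h] at this
    · exact (hz.right_cont t).mono Ioi_subset_Ici_self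
  · intro h
    exact h.continuousWithinAt.leftLim_eq

theorem IsCadlag.exists_lt_near_left {d : ℕ} {z : ℝ≥0 → Vec d} (hz : IsCadlag z) {t : ℝ≥0}
    (ht : 0 < t) {ε : ℝ} (hε : 0 < ε) :
    ∃ a < t, ∀ s, a < s → s < t → dist (z s) (leftVal z t) < ε := by
  obtain ⟨a, ha, h⟩ := (mem_nhdsLT_iff_exists_Ioo_subset' ht).1
    (hz.tendsto_leftVal t (Metric.ball_mem_nhds _ hε))
  exact ⟨a, ha, fun s hs hst => h ⟨hs, hst⟩⟩

/-- Jumps larger than a fixed `1/(k+1)` are isolated from the left: just before `t` all values are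
within half of that of `z(t-)`, so jumps there are too small. A set of left-isolated points is
countable. -/
theorem countable_disc {d : ℕ} {z : ℝ≥0 → Vec d} (hz : IsCadlag z) : (disc z).Countable := by
  have hsub : disc z ⊆ ⋃ k : ℕ, {t | (1 : ℝ) / (k + 1) < dist (leftVal z t) (z t)} := by
    intro t ht
    have hne : leftVal z t ≠ z t := fun h => ht ((leftVal_eq_iff_continuousAt hz).1 h)
    obtain ⟨k, hk⟩ := exists_nat_one_div_lt (dist_pos.2 hne)
    exact mem_iUnion.2 ⟨k, hk⟩
  refine (countable_iUnion fun k => ?_).mono hsub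
  have hiso := countable_setOfPred_isolated_left_within
    (s := {t | (1 : ℝ) / (k + 1) < dist (leftVal z t) (z t)})
  refine hiso.mono ?_
  intro t ht
  refine ⟨ht, ?_⟩
  have hpos : (0 : ℝ) < 1 / (k + 1) / 2 := by positivity
  rcases eq_or_ne t 0 with rfl | h0
  · have : (Iio (0 : ℝ≥0)) = ∅ := by ext; simp
    simp only [this, inter_empty, nhdsWithin_empty]
  obtain ⟨a, ha, h⟩ := hz.exists_lt_near_left (pos_iff_ne_zero.2 h0) hpos
  have hball : ∀ s, a < s → s < t → z s ∈ Metric.closedBall (leftVal z t) (1 / (k + 1) / 2) :=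
    fun s hs hst => (h s hs hst).le
  rw [← empty_mem_iff_bot, mem_nhdsWithin]
  refine ⟨Ioi a, isOpen_Ioi, ha, ?_⟩
  rintro s ⟨hs, hs', hst⟩
  have h1 := leftVal_mem_of_isClosed hz hs Metric.isClosed_closedBall
    fun r hr hrs => hball r hr (hrs.trans hst)
  have h2 := hball s hs hst
  rw [Metric.mem_closedBall] at h1 h2
  have h3 := dist_triangle_right (leftVal z s) (z s) (leftVal z t)
  have h4 : (1 : ℝ) / (k + 1) < dist (leftVal z s) (z s) := hs'
  exact absurd h4 (by linarith)

theorem exists_continuousAt_mem_Ioo {d : ℕ} {z : ℝ≥0 → Vec d} (hz : IsCadlag z) {a b : ℝ≥0}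
    (hab : a < b) : ∃ t, a < t ∧ t < b ∧ ContinuousAt z t := by
  have hab' : (a : ℝ) < b := hab
  obtain ⟨t, ht, h1, h2⟩ :=
    (((countable_disc hz).image NNReal.toReal).dense_compl ℝ).exists_between hab'
  lift t to ℝ≥0 using a.2.trans h1.le
  refine ⟨t, h1, h2, ?_⟩
  by_contra hc
  exact ht ⟨t, hc, rfl⟩

/-! ### Existence of parametric representations -/

/-- A right-continuous strictly increasing time change `τ` with left limits `τm`, which jumps at
every point of a given countable set. -/
structure TimeChange (D : Set ℝ≥0) where
  τ : ℝ≥0 → ℝ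
  τm : ℝ≥0 → ℝ
  lt_left : ∀ s t, s < t → τ s < τm t
  left_le : ∀ t, τm t ≤ τ t
  jump : ∀ t ∈ D, τm t < τ t
  tendsto_right : ∀ t, Tendsto τ (𝓝[>] t) (𝓝 (τ t))
  tendsto_left : ∀ t, Tendsto τ (𝓝[<] t) (𝓝 (τm t))
  zero : τm 0 = 0

/-- Take positive summable weights on `D` and add to `t` the weights of the points up to `t`; the
left limit omits the weight of `t` itself. Dominated convergence gives the one-sided limits. -/
theorem exists_timeChange {D : Set ℝ≥0} (hD : D.Countable) : Nonempty (TimeChange D) := by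
  obtain ⟨w, hw, c, hc, -⟩ := hD.exists_pos_hasSum_le one_pos
  have hsum : Summable fun i : D => w i := hc.summable
  have hnorm : ∀ (p : Prop) [Decidable p] (i : D), ‖(if p then w i else 0)‖ ≤ w i := by
    intro p _ i
    split_ifs
    · rw [Real.norm_of_nonneg (hw i).le]
    · simpa using (hw i).le
  have hsumm : ∀ (P : D → Prop) [DecidablePred P],
      Summable fun i : D => if P i then w i else 0 := fun P _ =>
    Summable.of_norm_bounded hsum fun i => hnorm (P i) i
  have hmono : ∀ (P Q : D → Prop) [DecidablePred P] [DecidablePred Q], (∀ i, P i → Q i) →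
      ∑' i : D, (if P i then w i else 0) ≤ ∑' i : D, (if Q i then w i else 0) := by
    intro P Q _ _ h
    refine (hsumm P).tsum_le_tsum (fun i => ?_) (hsumm Q)
    by_cases hP : P i
    · simp [hP, h i hP]
    · rw [if_neg hP]
      split_ifs
      exacts [(hw i).le, le_rfl]
  refine ⟨⟨fun t => t + ∑' i : D, (if (i : ℝ≥0) ≤ t then w i else 0),
    fun t => t + ∑' i : D, (if (i : ℝ≥0) < t then w i else 0), ?_, ?_, ?_, ?_, ?_, ?_⟩⟩
  · intro s t hst
    have h1 : (s : ℝ) < t := hst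
    have h2 := hmono (fun i => (i : ℝ≥0) ≤ s) (fun i => (i : ℝ≥0) < t)
      fun i hi => lt_of_le_of_lt hi hst
    exact add_lt_add_of_lt_of_le h1 h2
  · intro t
    have h2 := hmono (fun i => (i : ℝ≥0) < t) (fun i => (i : ℝ≥0) ≤ t) fun i hi => le_of_lt hi
    exact add_le_add_right h2 _
  · intro t ht
    have : ∑' i : D, (if (i : ℝ≥0) < t then w i else 0) <
        ∑' i : D, (if (i : ℝ≥0) ≤ t then w i else 0) := by
      refine Summable.tsum_lt_tsum (i := ⟨t, ht⟩) (fun i => ?_) ?_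
        (hsumm fun i => (i : ℝ≥0) < t) (hsumm fun i => (i : ℝ≥0) ≤ t)
      · by_cases hP : (i : ℝ≥0) < t
        · simp [hP, hP.le]
        · rw [if_neg hP]
          split_ifs
          exacts [(hw i).le, le_rfl]
      · simpa using hw t
    linarith
  · intro t
    refine Tendsto.add ?_ ?_
    · exact (NNReal.continuous_coe.tendsto t).mono_left nhdsWithin_le_nhds
    · refine tendsto_tsum_of_dominated_convergence hsum (fun i => ?_)
        (Eventually.of_forall fun s i => hnorm _ i)
      refine tendsto_const_nhds.congr' ?_
      by_cases hi : (i : ℝ≥0) ≤ t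
      · filter_upwards [self_mem_nhdsWithin] with s hs
        rw [if_pos hi, if_pos (hi.trans (le_of_lt hs))]
      · filter_upwards [Ioo_mem_nhdsGT (not_le.1 hi)] with s hs
        rw [if_neg hi, if_neg (not_le.2 hs.2)]
  · intro t
    refine Tendsto.add ?_ ?_
    · exact (NNReal.continuous_coe.tendsto t).mono_left nhdsWithin_le_nhds
    · refine tendsto_tsum_of_dominated_convergence hsum (fun i => ?_)
        (Eventually.of_forall fun s i => hnorm _ i)
      refine tendsto_const_nhds.congr' ?_
      by_cases hi : (i : ℝ≥0) < t
      · filter_upwards [Ioo_mem_nhdsLT hi] with s hs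
        rw [if_pos hi, if_pos hs.1.le]
      · filter_upwards [self_mem_nhdsWithin] with s hs
        rw [if_neg hi, if_neg (not_le.2 (lt_of_lt_of_le hs (not_lt.1 hi)))]
  · simp

namespace TimeChange

variable {D : Set ℝ≥0} (C : TimeChange D)

theorem strictMono : StrictMono C.τ := fun s t h => (C.lt_left s t h).trans_le (C.left_le t)

theorem nonneg (t : ℝ≥0) : 0 ≤ C.τ t := by
  have h := C.left_le 0
  rw [C.zero] at h
  exact h.trans (C.strictMono.monotone zero_le)

theorem exists_mem_Icc {T : ℝ≥0} {r : ℝ} (h0 : 0 ≤ r) (hT : r ≤ C.τ T) :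
    ∃ t ≤ T, C.τm t ≤ r ∧ r ≤ C.τ t := by
  set S := {t | r ≤ C.τ t} with hS
  have hne : S.Nonempty := ⟨T, hT⟩
  have hbdd : BddBelow S := OrderBot.bddBelow S
  refine ⟨sInf S, csInf_le hbdd hT, ?_, ?_⟩
  · rcases eq_or_ne (sInf S) 0 with h | h
    · rw [h, C.zero]
      exact h0
    · have : (𝓝[<] (sInf S)).NeBot := nhdsLT_neBot_of_exists_lt ⟨0, pos_iff_ne_zero.2 h⟩
      refine le_of_tendsto (C.tendsto_left _) ?_
      filter_upwards [self_mem_nhdsWithin] with s hs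
      by_contra hc
      exact absurd (csInf_le hbdd (show s ∈ S from (not_le.1 hc).le)) (not_le.2 hs)
  · refine ge_of_tendsto (C.tendsto_right _) ?_
    filter_upwards [self_mem_nhdsWithin] with s hs
    obtain ⟨u, hu, hus⟩ := exists_lt_of_csInf_lt hne hs
    exact (show r ≤ C.τ u from hu).trans (C.strictMono.monotone hus.le)

theorem le_of_le {r r' : ℝ} {t t' : ℝ≥0} (hr : r ≤ r') (h : C.τm t ≤ r) (h' : r' ≤ C.τ t') :
    t ≤ t' := by
  by_contra hc
  have := C.lt_left _ _ (not_le.1 hc)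
  linarith

/-- The generalized inverse of `τ`. -/
noncomputable def inv (T : ℝ≥0) (r : Icc (0 : ℝ) (C.τ T)) : Icc (0 : ℝ≥0) T :=
  ⟨(C.exists_mem_Icc r.2.1 r.2.2).choose, zero_le, (C.exists_mem_Icc r.2.1 r.2.2).choose_spec.1⟩

theorem left_le_inv (T : ℝ≥0) (r : Icc (0 : ℝ) (C.τ T)) : C.τm (C.inv T r) ≤ r :=
  (C.exists_mem_Icc r.2.1 r.2.2).choose_spec.2.1

theorem le_inv (T : ℝ≥0) (r : Icc (0 : ℝ) (C.τ T)) : r ≤ C.τ (C.inv T r) :=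
  (C.exists_mem_Icc r.2.1 r.2.2).choose_spec.2.2

theorem inv_eq {T : ℝ≥0} {r : Icc (0 : ℝ) (C.τ T)} {t : ℝ≥0} (h : C.τm t ≤ r) (h' : r ≤ C.τ t) :
    (C.inv T r : ℝ≥0) = t :=
  le_antisymm (C.le_of_le le_rfl (C.left_le_inv T r) h') (C.le_of_le le_rfl h (C.le_inv T r))

theorem left_nonneg (t : ℝ≥0) : 0 ≤ C.τm t := by
  rcases eq_or_ne t 0 with rfl | h
  · exact C.zero.ge
  · exact (C.nonneg 0).trans (C.lt_left 0 t (pos_iff_ne_zero.2 h)).le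

theorem inv_monotone (T : ℝ≥0) : Monotone (C.inv T) := fun r r' h =>
  C.le_of_le (show (r : ℝ) ≤ r' from h) (C.left_le_inv T r) (C.le_inv T r')

theorem inv_continuous (T : ℝ≥0) : Continuous (C.inv T) := by
  have : Fact ((0 : ℝ≥0) ≤ T) := ⟨zero_le⟩
  refine (C.inv_monotone T).continuous_of_surjective fun t => ?_
  refine ⟨⟨C.τ t, C.nonneg t, C.strictMono.monotone t.2.2⟩, Subtype.ext ?_⟩
  exact C.inv_eq (C.left_le t) le_rfl

/-- The position of `r` in the jump of `τ` which contains it. -/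
noncomputable def frac (T : ℝ≥0) (r : Icc (0 : ℝ) (C.τ T)) : ℝ :=
  ((r : ℝ) - C.τm (C.inv T r)) / (C.τ (C.inv T r) - C.τm (C.inv T r))

theorem frac_mem (T : ℝ≥0) (r : Icc (0 : ℝ) (C.τ T)) : C.frac T r ∈ Icc (0 : ℝ) 1 := by
  have h1 := C.left_le_inv T r
  have h2 := C.le_inv T r
  exact ⟨div_nonneg (by linarith) (by linarith), div_le_one_of_le₀ (by linarith) (by linarith)⟩

/-- The spatial component of the parametrization of a completed graph. -/
noncomputable def space {d : ℕ} (z : ℝ≥0 → Vec d) (T : ℝ≥0) (r : Icc (0 : ℝ) (C.τ T)) : Vec d :=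
  leftVal z (C.inv T r) + C.frac T r • (z (C.inv T r) - leftVal z (C.inv T r))

theorem space_mem {d : ℕ} (z : ℝ≥0 → Vec d) (T : ℝ≥0) (r : Icc (0 : ℝ) (C.τ T)) :
    C.space z T r ∈ segment ℝ (leftVal z (C.inv T r)) (z (C.inv T r)) := by
  rw [segment_eq_image']
  exact ⟨_, C.frac_mem T r, rfl⟩

theorem space_congr {d : ℕ} {z : ℝ≥0 → Vec d} {T : ℝ≥0} {r : Icc (0 : ℝ) (C.τ T)} {t : ℝ≥0}
    (h : (C.inv T r : ℝ≥0) = t) : C.space z T r =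
      leftVal z t + (((r : ℝ) - C.τm t) / (C.τ t - C.τm t)) • (z t - leftVal z t) := by
  subst h
  rfl

/-- Off `disc z` the function `τ` may be continuous, and then `frac` is the default value `0 / 0 =
0`. This is harmless since the two ends of the vertical segment coincide. -/
theorem space_right {d : ℕ} {z : ℝ≥0 → Vec d} (hz : IsCadlag z) (C : TimeChange (disc z))
    {T : ℝ≥0} {r : Icc (0 : ℝ) (C.τ T)} (h : (r : ℝ) = C.τ (C.inv T r)) :
    C.space z T r = z (C.inv T r) := by
  rw [C.space_congr rfl]
  by_cases hd : (C.inv T r : ℝ≥0) ∈ disc z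
  · have := C.jump _ hd
    rw [h, div_self (by linarith), one_smul]
    abel
  · rw [(leftVal_eq_iff_continuousAt hz).2 (not_not.1 hd)]
    simp

theorem space_left {d : ℕ} (z : ℝ≥0 → Vec d) (C : TimeChange (disc z))
    {T : ℝ≥0} {r : Icc (0 : ℝ) (C.τ T)} (h : (r : ℝ) = C.τm (C.inv T r)) :
    C.space z T r = leftVal z (C.inv T r) := by
  rw [C.space_congr rfl, h]
  simp

/-- On each side of `r₀` there are two cases. Either nearby parameters stay in the same jump
interval of `τ`, where the formula is affine, or `r₀` is an end of that interval. In the latter case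
nearby points lie on segments whose ends are both close to the one-sided limit of `z`, and balls are
convex. -/
theorem space_continuous {d : ℕ} {z : ℝ≥0 → Vec d} (hz : IsCadlag z) (C : TimeChange (disc z))
    (T : ℝ≥0) : Continuous (C.space z T) := by
  refine continuous_iff_continuousAt.2 fun r₀ => ?_
  set t₀ : ℝ≥0 := (C.inv T r₀ : ℝ≥0) with ht₀
  have hG : Continuous fun r : Icc (0 : ℝ) (C.τ T) =>
      leftVal z t₀ + (((r : ℝ) - C.τm t₀) / (C.τ t₀ - C.τm t₀)) • (z t₀ - leftVal z t₀) := by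
    fun_prop
  have hinv : Tendsto (fun r => (C.inv T r : ℝ≥0)) (𝓝 r₀) (𝓝 t₀) :=
    (continuous_subtype_val.comp (C.inv_continuous T)).tendsto r₀
  have hle : ∀ r s : Icc (0 : ℝ) (C.τ T), r ≤ s → (C.inv T r : ℝ≥0) ≤ C.inv T s :=
    fun r s h => C.inv_monotone T h
  refine continuousAt_iff_continuous_left_right.2 ⟨?_, ?_⟩
  · rcases (C.left_le_inv T r₀).eq_or_lt with h | h
    · rw [ContinuousWithinAt, space_left z C h.symm, ← ht₀, Metric.tendsto_nhds]
      intro ε hε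
      obtain ⟨δ, hδ, hnear⟩ := hz.exists_near_left t₀ (half_pos hε)
      have hev : ∀ᶠ r in 𝓝 r₀, (t₀ : ℝ) < (C.inv T r : ℝ≥0) + δ / 2 := by
        have := ((NNReal.continuous_coe.tendsto _).comp hinv).add_const (δ / 2)
        exact this.eventually_const_lt (by linarith)
      filter_upwards [self_mem_nhdsWithin, hev.filter_mono nhdsWithin_le_nhds] with r hr hr'
      rcases (hle r r₀ hr).eq_or_lt with he | hlt
      · have : r = r₀ := by
          refine le_antisymm hr (Subtype.coe_le_coe.1 ?_)
          rw [← h, ← he]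
          exact C.left_le_inv T r
        rw [this, space_left z C h.symm, ← ht₀, dist_self]
        exact hε
      · have h1 : ∀ s : ℝ≥0, ((C.inv T r : ℝ≥0) : ℝ) - δ / 2 < (s : ℝ) → s ≤ C.inv T r →
            z s ∈ Metric.closedBall (leftVal z t₀) (ε / 2) := by
          intro s hs hs'
          exact (hnear s (lt_of_le_of_lt hs' hlt) (by linarith)).le
        have h2 : leftVal z (C.inv T r) ∈ Metric.closedBall (leftVal z t₀) (ε / 2) := by
          -- At time `0` there are no earlier values to take a limit of; the convention `z(0-) =
          -- z(0)` serves instead.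
          rcases eq_or_ne ((C.inv T r : ℝ≥0)) 0 with h0 | h0
          · rw [h0, leftVal_zero, ← h0]
            exact h1 _ (by linarith) le_rfl
          · have h3 : (C.inv T r : ℝ≥0) - (δ / 2).toNNReal < C.inv T r :=
              tsub_lt_self (pos_iff_ne_zero.2 h0) (by simpa using hδ)
            refine leftVal_mem_of_isClosed hz h3 Metric.isClosed_closedBall fun s hs hs' => ?_
            refine h1 s ?_ hs'.le
            have h4 : ((C.inv T r : ℝ≥0) : ℝ) - (δ / 2).toNNReal ≤
                ((C.inv T r : ℝ≥0) - (δ / 2).toNNReal : ℝ≥0) := by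
              rw [NNReal.coe_sub_def]
              exact le_max_left _ _
            rw [Real.coe_toNNReal _ (by linarith)] at h4
            exact h4.trans_lt hs
        have h3 := (convex_closedBall (leftVal z t₀) (ε / 2)).segment_subset h2
          (h1 _ (by linarith) le_rfl) (C.space_mem z T r)
        exact (Metric.mem_closedBall.1 h3).trans_lt (by linarith)
    · refine (hG.continuousAt.continuousWithinAt).congr_of_eventuallyEq ?_ (C.space_congr rfl)
      have hev : ∀ᶠ r : Icc (0 : ℝ) (C.τ T) in 𝓝 r₀, C.τm t₀ < (r : ℝ) :=
        (continuous_subtype_val.tendsto r₀).eventually_const_lt h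
      filter_upwards [self_mem_nhdsWithin, hev.filter_mono nhdsWithin_le_nhds] with r hr hr'
      exact C.space_congr (C.inv_eq hr'.le ((show (r : ℝ) ≤ r₀ from hr).trans (C.le_inv T r₀)))
  · rcases (C.le_inv T r₀).eq_or_lt with h | h
    · rw [ContinuousWithinAt, space_right hz C h, ← ht₀, Metric.tendsto_nhds]
      intro ε hε
      obtain ⟨δ, hδ, hnear⟩ := hz.exists_near_right t₀ (half_pos hε)
      have hev : ∀ᶠ r in 𝓝 r₀, ((C.inv T r : ℝ≥0) : ℝ) < t₀ + δ := by
        have := (NNReal.continuous_coe.tendsto _).comp hinv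
        exact this.eventually_lt_const (by linarith)
      filter_upwards [self_mem_nhdsWithin, hev.filter_mono nhdsWithin_le_nhds] with r hr hr'
      rcases (hle r₀ r hr).eq_or_lt with he | hlt
      · have : r = r₀ := by
          refine le_antisymm (Subtype.coe_le_coe.1 ?_) hr
          rw [h, he]
          exact C.le_inv T r
        rw [this, space_right hz C h, ← ht₀, dist_self]
        exact hε
      · have h1 : ∀ s, t₀ ≤ s → s ≤ C.inv T r →
            z s ∈ Metric.closedBall (z t₀) (ε / 2) := by
          intro s hs hs'
          exact (hnear s hs (lt_of_le_of_lt hs' hr')).le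
        have h2 : leftVal z (C.inv T r) ∈ Metric.closedBall (z t₀) (ε / 2) :=
          leftVal_mem_of_isClosed hz hlt Metric.isClosed_closedBall
            fun s hs hs' => h1 s hs.le hs'.le
        have h3 := (convex_closedBall (z t₀) (ε / 2)).segment_subset h2
          (h1 _ hlt.le le_rfl) (C.space_mem z T r)
        exact (Metric.mem_closedBall.1 h3).trans_lt (by linarith)
    · refine (hG.continuousAt.continuousWithinAt).congr_of_eventuallyEq ?_ (C.space_congr rfl)
      have hev : ∀ᶠ r : Icc (0 : ℝ) (C.τ T) in 𝓝 r₀, (r : ℝ) < C.τ t₀ :=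
        (continuous_subtype_val.tendsto r₀).eventually_lt_const h
      filter_upwards [self_mem_nhdsWithin, hev.filter_mono nhdsWithin_le_nhds] with r hr hr'
      exact C.space_congr (C.inv_eq ((C.left_le_inv T r₀).trans (show (r₀ : ℝ) ≤ r from hr)) hr'.le)

end TimeChange

/-- Without this the infimum defining `distSM1` could be taken over an empty family. Opening every
jump into an interval by `τ` and running through the vertical segment there at constant speed gives
the representation. -/
theorem exists_paramRep {d : ℕ} (z : Cadlag d) {T : ℝ≥0} (hT : 0 < T) :
    Nonempty (ParamRep T z) := by
  have hz := z.isCadlag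
  obtain ⟨C⟩ := exists_timeChange (countable_disc hz)
  have hpos : 0 < C.τ T := (C.nonneg 0).trans_lt (C.strictMono hT)
  let e : unitInterval → Icc (0 : ℝ) (C.τ T) := fun s =>
    ⟨s * C.τ T, mul_nonneg s.2.1 hpos.le, mul_le_of_le_one_left hpos.le s.2.2⟩
  have he : Continuous e := by
    refine Continuous.subtype_mk ?_ _
    fun_prop
  refine ⟨⟨fun s => (C.space z T (e s), C.inv T (e s)), ?_, ?_, ?_⟩⟩
  · exact ((TimeChange.space_continuous hz C T).comp he).prodMk
      (continuous_subtype_val.comp ((C.inv_continuous T).comp he))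
  · ext ⟨p, t⟩
    constructor
    · rintro ⟨s, hs⟩
      obtain ⟨rfl, rfl⟩ := Prod.mk.inj hs
      exact ⟨(C.inv T (e s)).2.2, C.space_mem z T (e s)⟩
    · rintro ⟨ht, hp⟩
      dsimp only at ht hp
      rw [segment_eq_image'] at hp
      obtain ⟨c, hc, rfl⟩ := hp
      have hle := C.left_le t
      have h1 : C.τm t ≤ C.τm t + c * (C.τ t - C.τm t) :=
        le_add_of_nonneg_right (mul_nonneg hc.1 (by linarith))
      have h2 : C.τm t + c * (C.τ t - C.τm t) ≤ C.τ t := by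
        have := mul_le_of_le_one_left (sub_nonneg.2 hle) hc.2
        linarith
      set r := C.τm t + c * (C.τ t - C.τm t) with hr
      have h3 : r ≤ C.τ T := h2.trans (C.strictMono.monotone ht)
      have h0 : 0 ≤ r := (C.left_nonneg t).trans h1
      let q : unitInterval := ⟨r / C.τ T, div_nonneg h0 hpos.le, div_le_one_of_le₀ h3 hpos.le⟩
      have hes : e q = ⟨r, h0, h3⟩ := Subtype.ext (div_mul_cancel₀ r hpos.ne')
      refine ⟨q, ?_⟩
      change (C.space z T (e q), (C.inv T (e q) : ℝ≥0)) =
        (leftVal z t + c • (z t - leftVal z t), t)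
      have hinv : (C.inv T ⟨r, h0, h3⟩ : ℝ≥0) = t := C.inv_eq h1 h2
      rw [hes, C.space_congr hinv, hinv]
      refine Prod.ext ?_ rfl
      by_cases hd : t ∈ disc z
      · have hj := C.jump t hd
        have : (r - C.τm t) / (C.τ t - C.τm t) = c := by
          rw [hr, add_sub_cancel_left, mul_div_cancel_right₀ _ (by linarith)]
        simp only [this]
      · simp [(leftVal_eq_iff_continuousAt hz).2 (not_not.1 hd)]
  · intro s s' hs
    have hes : e s ≤ e s' := mul_le_mul_of_nonneg_right (show (s : ℝ) ≤ s' from hs) hpos.le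
    rcases (show (C.inv T (e s) : ℝ≥0) ≤ C.inv T (e s') from C.inv_monotone T hes).lt_or_eq with
      h | h
    · exact Or.inl h
    · refine Or.inr ⟨h, ?_⟩
      dsimp only
      rw [C.space_congr h, C.space_congr (r := e s') rfl]
      have key : ∀ (a b : Vec d) (c : ℝ), 0 ≤ c → ‖a - (a + c • b)‖ = c * ‖b‖ := by
        intro a b c hc
        rw [sub_add_cancel_left, norm_neg, norm_smul, Real.norm_of_nonneg hc]
      have hle := C.left_le (C.inv T (e s'))
      have h1 := C.left_le_inv T (e s)
      rw [h] at h1 ⊢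
      have h2 : (e s : ℝ) ≤ e s' := hes
      rw [key _ _ _ (div_nonneg (by linarith) (by linarith)),
        key _ _ _ (div_nonneg (by linarith) (by linarith))]
      refine mul_le_mul_of_nonneg_right ?_ (norm_nonneg _)
      exact div_le_div_of_nonneg_right (by linarith) (by linarith)

/-! ### Geometry of stairs -/

section Stairs

variable {d : ℕ} {z : ℝ≥0 → Vec d}

theorem coe_thetaFin {t : ℝ≥0} (h : theta z t ≠ ⊤) : (thetaFin z t : ℝ≥0∞) = theta z t :=
  ENNReal.coe_toNNReal h

theorem lt_theta_iff {s t : ℝ≥0} (h : theta z t ≠ ⊤) :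
    (s : ℝ≥0∞) < theta z t ↔ s < thetaFin z t := by
  rw [← coe_thetaFin h]
  exact ENNReal.coe_lt_coe

theorem le_thetaFin {t : ℝ≥0} (h : theta z t ≠ ⊤) : t ≤ thetaFin z t := by
  have := le_theta z t
  rw [← coe_thetaFin h] at this
  exact_mod_cast this

theorem apply_eta (hz : IsCadlag z) (t : ℝ≥0) : z (eta z t) = z t := by
  rcases (eta_le z t).eq_or_lt with h | h
  · rw [h]
  · have h1 : Tendsto z (𝓝[>] (eta z t)) (𝓝 (z (eta z t))) :=
      (hz.right_cont _).mono Ioi_subset_Ici_self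
    refine tendsto_nhds_unique h1 (tendsto_const_nhds.congr' ?_)
    filter_upwards [Ioo_mem_nhdsGT h] with s hs using (eq_of_eta_lt hs.1 hs.2.le).symm

theorem apply_eq_of_mem_stair (hz : IsCadlag z) {s t : ℝ≥0} (h1 : eta z t ≤ s)
    (h2 : (s : ℝ≥0∞) < theta z t) : z s = z t := by
  rcases le_total s t with h | h
  · rcases h1.eq_or_lt with h1 | h1
    · rw [← h1, apply_eta hz]
    · exact eq_of_eta_lt h1 h
  · exact eq_of_lt_theta h h2

theorem theta_le_of_ne_leftVal {s t : ℝ≥0} (hs : t ≤ s) (h : z s ≠ leftVal z t) :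
    theta z t ≤ s := by
  refine sInf_le ?_
  exact ⟨s, hs, h, rfl⟩

/-- Two different values cannot both equal `z(t-)`, so no knowledge of the left limit is needed. -/
theorem theta_le_max {t p q : ℝ≥0} (hp : t ≤ p) (hq : t ≤ q) (h : z p ≠ z q) :
    theta z t ≤ (max p q : ℝ≥0) := by
  by_cases hpl : z p = leftVal z t
  · refine (theta_le_of_ne_leftVal hq fun hql => h (hpl.trans hql.symm)).trans ?_
    exact_mod_cast le_max_right p q
  · refine (theta_le_of_ne_leftVal hp hpl).trans ?_
    exact_mod_cast le_max_left p q

theorem theta_le_of_ne {t q : ℝ≥0} (hq : t ≤ q) (h : z t ≠ z q) : theta z t ≤ q := by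
  have := theta_le_max le_rfl hq h
  rwa [max_eq_right hq] at this

/-- Stairs do not overlap: arbitrarily close before `η(t)`, or at it, there is a value different
from `z(t) = z(η(t))`, which ends any constancy begun at `s`. -/
theorem theta_le_eta (hz : IsCadlag z) {s t : ℝ≥0} (h : s < eta z t) :
    theta z s ≤ eta z t := by
  obtain ⟨r, hr, hsr⟩ := exists_lt_of_lt_csSup' (show s < sSup {r | r < t ∧ z r ≠ z t} from h)
  have hre : r ≤ eta z t := le_csSup ⟨t, fun r hr => hr.1.le⟩ hr
  have := theta_le_max hsr.le h.le (show z r ≠ z (eta z t) by rw [apply_eta hz]; exact hr.2)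
  rwa [max_eq_right hre] at this

theorem eta_eta (hz : IsCadlag z) (t : ℝ≥0) : eta z (eta z t) = eta z t := by
  refine le_antisymm (eta_le _ _) ?_
  conv_lhs => rw [eta]
  refine csSup_le' ?_
  rintro s ⟨hst, hne⟩
  by_contra hlt
  rcases le_total s (eta z t) with h | h
  · exact hne ((eq_of_eta_lt (not_le.1 hlt) h).trans (apply_eta hz t))
  · rcases h.eq_or_lt with rfl | h
    · exact hne (apply_eta hz t)
    · exact hne (eq_of_eta_lt h hst.le)

theorem leftVal_thetaFin (hz : IsCadlag z) {t : ℝ≥0} (h : (t : ℝ≥0∞) < theta z t)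
    (hfin : theta z t ≠ ⊤) : leftVal z (thetaFin z t) = z t :=
  leftVal_eq_of_eqOn hz ((lt_theta_iff hfin).1 h) fun _ hs hs' =>
    eq_of_lt_theta hs.le ((lt_theta_iff hfin).2 hs')

theorem theta_thetaFin (hz : IsCadlag z) {t : ℝ≥0} (hfin : theta z t ≠ ⊤) :
    theta z (thetaFin z t) = thetaFin z t := by
  rcases (le_theta z t).eq_or_lt with h | h
  · have : thetaFin z t = t := by rw [thetaFin, ← h, ENNReal.toNNReal_coe]
    rw [this, h]
  · refine le_antisymm ?_ (le_theta _ _)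
    by_contra hlt
    rw [not_le] at hlt
    have hc := leftVal_thetaFin hz h hfin
    have hle : theta z (thetaFin z t) ≤ theta z t := by
      conv_rhs => rw [theta]
      refine le_sInf ?_
      rintro _ ⟨s, hs, hne, rfl⟩
      by_contra hs'
      rw [not_le] at hs'
      rw [← eq_leftVal_of_lt_theta le_rfl h] at hne
      rcases lt_or_ge s (thetaFin z t) with h1 | h1
      · exact hne (eq_of_lt_theta hs ((lt_theta_iff hfin).2 h1))
      · exact hne ((eq_leftVal_of_lt_theta h1 hs').trans hc)
    rw [← coe_thetaFin hfin] at hle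
    exact absurd hlt (not_lt.2 hle)

theorem stairFun_thetaFin (hz : IsCadlag z) {t : ℝ≥0} (hfin : theta z t ≠ ⊤) :
    stairFun z (thetaFin z t) = z (thetaFin z t) :=
  stairFun_of_theta_eq (theta_thetaFin hz hfin)

theorem stairFun_mem_segment (hz : IsCadlag z) {t : ℝ≥0} (hfin : theta z t ≠ ⊤) :
    stairFun z t ∈ segment ℝ (z t) (z (thetaFin z t)) := by
  classical
  rw [stairFun, if_neg hfin, apply_eta hz, segment_eq_image']
  have ha : (eta z t : ℝ) ≤ t := by exact_mod_cast eta_le z t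
  have hb : (t : ℝ) ≤ thetaFin z t := by exact_mod_cast le_thetaFin hfin
  exact ⟨_, ⟨div_nonneg (by linarith) (by linarith),
    div_le_one_of_le₀ (by linarith) (by linarith)⟩, rfl⟩

theorem constOn_stair (z : ℝ≥0 → Vec d) {t : ℝ≥0} (hfin : theta z t ≠ ⊤) :
    ConstOn z (Ioo (eta z t) (thetaFin z t)) := by
  have aux : ∀ u ∈ Ioo (eta z t) (thetaFin z t), z u = z t := fun u hu => by
    rcases le_total u t with h | h
    · exact eq_of_eta_lt hu.1 h
    · exact eq_of_lt_theta h ((lt_theta_iff hfin).2 hu.2)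
  intro u hu v hv
  rw [aux u hu, aux v hv]

/-- The affine formula for `stairFun` on a whole closed stair. -/
theorem stairFun_eq_of_mem_stair (hz : IsCadlag z) {s t : ℝ≥0} (hη : eta z t < t)
    (hθ : (t : ℝ≥0∞) < theta z t) (hfin : theta z t ≠ ⊤) (h1 : eta z t ≤ s)
    (h2 : s ≤ thetaFin z t) :
    stairFun z s = z t + (((s : ℝ) - eta z t) / ((thetaFin z t : ℝ) - eta z t)) •
      (z (thetaFin z t) - z t) := by
  classical
  have ht : t ∈ Ioo (eta z t) (thetaFin z t) := ⟨hη, (lt_theta_iff hfin).1 hθ⟩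
  rcases h1.eq_or_lt with rfl | h1
  · rw [stairFun_of_eta_eq (eta_eta hz t), apply_eta hz]
    simp
  rcases h2.eq_or_lt with rfl | h2
  · have : (eta z t : ℝ) < thetaFin z t := by exact_mod_cast ht.1.trans ht.2
    rw [stairFun_thetaFin hz hfin, div_self (by linarith), one_smul]
    abel
  · have hc := constOn_stair z hfin
    have hs : s ∈ Ioo (eta z t) (thetaFin z t) := ⟨h1, h2⟩
    rw [stairFun, thetaFin, theta_eq_of_const hc hs ht, if_neg hfin, eta_eq_of_const hc hs ht,
      apply_eta hz]
    rfl

theorem eta_le_of_const {a b t : ℝ≥0} (h : ConstOn z (Ioo a b)) (ht : t ∈ Ioo a b) :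
    eta z t ≤ a := by
  refine csSup_le' ?_
  rintro s ⟨hst, hne⟩
  by_contra hlt
  exact hne (h s ⟨not_le.1 hlt, hst.trans ht.2⟩ t ht)

theorem le_theta_of_const {a b t : ℝ≥0} (h : ConstOn z (Ioo a b)) (ht : t ∈ Ioo a b) :
    (b : ℝ≥0∞) ≤ theta z t := by
  refine le_sInf ?_
  rintro _ ⟨s, hs, hne, rfl⟩
  rw [leftVal_of_const h ht] at hne
  by_contra hlt
  exact hne (h s ⟨ht.1.trans_le hs, by simpa using hlt⟩ t ht)

/-- The infimum `θ` need not be attained: if `z` is continuous there, the value changes only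
immediately afterwards. -/
theorem exists_ne_near_thetaFin {t : ℝ≥0} (hθ : (t : ℝ≥0∞) < theta z t) (hfin : theta z t ≠ ⊤)
    {v : ℝ≥0} (hv : thetaFin z t < v) : ∃ s, thetaFin z t ≤ s ∧ s < v ∧ z s ≠ z t := by
  by_contra! hcon
  have : (v : ℝ≥0∞) ≤ theta z t := by
    refine le_sInf ?_
    rintro _ ⟨s, hs, hne, rfl⟩
    rw [← eq_leftVal_of_lt_theta le_rfl hθ] at hne
    by_contra hlt
    have hsv : s < v := by simpa using hlt
    rcases lt_or_ge s (thetaFin z t) with h1 | h1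
    · exact hne (eq_of_lt_theta hs ((lt_theta_iff hfin).2 h1))
    · exact hne (hcon s h1 hsv)
  rw [← coe_thetaFin hfin, ENNReal.coe_le_coe] at this
  exact absurd hv (not_lt.2 this)

end Stairs

/-- The only nontrivial case is a constancy interval around `t` without a jump at its end. Its two
ends then carry the same value, and the interpolation is constant. -/
theorem stairFun_of_not_inStair {d : ℕ} {x : Cadlag d} {t : ℝ≥0} (hfin : theta x t < ⊤)
    (h : ¬ InStair x t) : stairFun x t = x t := by
  classical
  rcases (eta_le x t).eq_or_lt with hη | hη
  · exact stairFun_of_eta_eq hη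
  rcases (le_theta x t).eq_or_lt with hθ | hθ
  · exact stairFun_of_theta_eq hθ.symm
  have hd : thetaFin x t ∉ disc x := fun hd => h ⟨hη, hθ, hfin, constOn_stair x hfin.ne, hd⟩
  have hl := leftVal_thetaFin x.isCadlag hθ hfin.ne
  rw [(leftVal_eq_iff_continuousAt x.isCadlag).2 (not_not.1 hd)] at hl
  rw [stairFun, if_neg hfin.ne, apply_eta x.isCadlag, hl]
  simp

/-! ### `J₁` convergence through matchings of the half-line -/

/-- The time change `lam` matches `z` with `x` on `[0, T]` up to `ε`. -/
structure IsMatching {d : ℕ} (ε : ℝ) (T : ℝ≥0) (lam : ℝ≥0 ≃o ℝ≥0) (z x : ℝ≥0 → Vec d) :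
    Prop where
  time : ∀ t, |(lam t : ℝ) - t| < ε
  space : ∀ t ≤ T, dist (z (lam t)) (x t) < ε

theorem IsMatching.mono {d : ℕ} {ε ε' : ℝ} {T T' : ℝ≥0} {lam : ℝ≥0 ≃o ℝ≥0} {z x : ℝ≥0 → Vec d}
    (h : IsMatching ε T lam z x) (hε : ε ≤ ε') (hT : T' ≤ T) : IsMatching ε' T' lam z x :=
  ⟨fun t => (h.time t).trans_le hε, fun t ht => (h.space t (ht.trans hT)).trans_le hε⟩

/-- `J₁` convergence, expressed with increasing bijections of the half-line. -/
def MatchConv {d : ℕ} (xn : ℕ → Cadlag d) (x : Cadlag d) : Prop :=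
  ∀ (T : ℝ≥0) (ε : ℝ), 0 < ε → ∀ᶠ n in atTop, ∃ lam, IsMatching ε T lam (xn n) x

/-- The hypothesis on the stairs of the limit. -/
def StairConv {d : ℕ} (xn : ℕ → Cadlag d) (x : Cadlag d) : Prop :=
  ∀ t : ℝ≥0, InStair x t →
      ∃ tn : ℕ → ℝ≥0, Tendsto tn atTop (𝓝 t) ∧
        Tendsto (fun n => eta (xn n) (tn n)) atTop (𝓝 (eta x t)) ∧
        Tendsto (fun n => theta (xn n) (tn n)) atTop (𝓝 (theta x t)) ∧
        Tendsto (fun n => ‖xn n (thetaFin (xn n) (tn n)) -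
            leftVal (xn n) (thetaFin (xn n) (tn n))‖) atTop
          (𝓝 ‖x (thetaFin x t) - leftVal x (thetaFin x t)‖)

/-- The constant sequence satisfies the same hypotheses, so every asymptotic statement about `xn`
also yields one about `x` itself. -/
theorem matchConv_const {d : ℕ} (x : Cadlag d) : MatchConv (fun _ => x) x := fun _ _ hε =>
  Eventually.of_forall fun _ => ⟨OrderIso.refl _, fun t => by simpa using hε,
    fun t _ => by simpa using hε⟩

theorem stairConv_const {d : ℕ} (x : Cadlag d) : StairConv (fun _ => x) x := fun t _ =>
  ⟨fun _ => t, tendsto_const_nhds, tendsto_const_nhds, tendsto_const_nhds, tendsto_const_nhds⟩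

theorem exists_orderIso_extend {T : ℝ≥0} (lam : Icc (0 : ℝ≥0) T ≃o Icc (0 : ℝ≥0) T) :
    ∃ g : ℝ≥0 ≃o ℝ≥0, (∀ t : Icc (0 : ℝ≥0) T, g t = lam t) ∧ ∀ t, T < t → g t = t := by
  classical
  let f : ℝ≥0 → ℝ≥0 := fun t => if h : t ≤ T then lam ⟨t, zero_le, h⟩ else t
  have f1 : ∀ t : Icc (0 : ℝ≥0) T, f t = lam t := fun t => dif_pos t.2.2
  have f2 : ∀ t, T < t → f t = t := fun t ht => dif_neg (not_le.2 ht)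
  have hmono : StrictMono f := by
    intro s t hst
    rcases le_or_gt t T with ht | ht
    · have h1 := f1 ⟨s, zero_le, hst.le.trans ht⟩
      have h2 := f1 ⟨t, zero_le, ht⟩
      dsimp only at h1 h2
      rw [h1, h2]
      exact lam.strictMono hst
    · rw [f2 t ht]
      rcases le_or_gt s T with hs | hs
      · have h1 := f1 ⟨s, zero_le, hs⟩
        dsimp only at h1
        rw [h1]
        exact (lam _).2.2.trans_lt ht
      · rwa [f2 s hs]
  have hsurj : Function.Surjective f := by
    intro t
    rcases le_or_gt t T with ht | ht
    · refine ⟨lam.symm ⟨t, zero_le, ht⟩, ?_⟩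
      rw [f1, OrderIso.apply_symm_apply]
    · exact ⟨t, f2 t ht⟩
  exact ⟨hmono.orderIsoOfSurjective f hsurj, f1, f2⟩

theorem TendstoJ1.matchConv {d : ℕ} {xn : ℕ → Cadlag d} {x : Cadlag d} (h : TendstoJ1 xn x) :
    MatchConv xn x := by
  intro T ε hε
  -- `J₁` convergence is only available at continuity horizons, so `T` is enlarged to one.
  obtain ⟨T', hT, -, hc⟩ := exists_continuousAt_mem_Ioo x.isCadlag (lt_add_one T)
  have h1 := h T' (zero_le.trans_lt hT) (not_not.2 hc)
  filter_upwards [h1.eventually_lt_const (ENNReal.ofReal_pos.2 hε)] with n hn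
  obtain ⟨lam, hlam⟩ := iInf_lt_iff.1 hn
  obtain ⟨g, hg1, hg2⟩ := exists_orderIso_extend lam
  rw [max_lt_iff] at hlam
  have hx : ∀ t : Icc (0 : ℝ≥0) T', dist (xn n (lam t)) (x t) < ε := fun t => by
    rw [← ENNReal.ofReal_lt_ofReal_iff hε, ← edist_dist]
    exact (le_iSup (fun t : Icc (0 : ℝ≥0) T' => edist (xn n (lam t)) (x t)) t).trans_lt hlam.1
  have ht : ∀ t : Icc (0 : ℝ≥0) T', dist (lam t) t < ε := fun t => by
    rw [← ENNReal.ofReal_lt_ofReal_iff hε, ← edist_dist]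
    exact (le_iSup (fun t : Icc (0 : ℝ≥0) T' => edist (lam t) t) t).trans_lt hlam.2
  refine ⟨g, fun t => ?_, fun t hle => ?_⟩
  · rcases le_or_gt t T' with h' | h'
    · have := ht ⟨t, zero_le, h'⟩
      rw [Subtype.dist_eq, NNReal.dist_eq, ← hg1] at this
      exact this
    · rw [hg2 t h']
      simpa using hε
  · have := hx ⟨t, zero_le, hle.trans hT.le⟩
    rwa [← hg1] at this

theorem leftVal_mem_of_eventually {d : ℕ} {z : ℝ≥0 → Vec d} (hz : IsCadlag z) {t : ℝ≥0}
    {K : Set (Vec d)} (hK : IsClosed K) (h : ∀ᶠ s in 𝓝[<] t, z s ∈ K) (ht : z t ∈ K) :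
    leftVal z t ∈ K := by
  rcases eq_or_ne t 0 with rfl | h0
  · rwa [leftVal_zero]
  · have : (𝓝[<] t).NeBot := nhdsLT_neBot_of_exists_lt ⟨0, pos_iff_ne_zero.2 h0⟩
    exact hK.mem_of_tendsto (hz.tendsto_leftVal t) h

/-- Pulling `s` back by `lam` moves it by less than `δ`, hence to within `2δ` of `t₀` and on the
same side of `t₀` as `s` is of `lam t₀`. The one-sided limits of `x` then apply; the bound `1/2` on
`δ` keeps the preimage below `t₀ + 1`. -/
theorem exists_near_of_isMatching {d : ℕ} (x : Cadlag d) (t₀ : ℝ≥0) {ε : ℝ} (hε : 0 < ε) :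
    ∃ δ > (0 : ℝ), ∀ (z : ℝ≥0 → Vec d) (lam : ℝ≥0 ≃o ℝ≥0), IsMatching δ (t₀ + 1) lam z x →
      ∀ s : ℝ≥0, |(s : ℝ) - t₀| < δ → (s < lam t₀ → dist (z s) (leftVal x t₀) < ε) ∧
        (lam t₀ ≤ s → dist (z s) (x t₀) < ε) := by
  obtain ⟨δ₁, h₁, hl⟩ := x.isCadlag.exists_near_left t₀ (half_pos hε)
  obtain ⟨δ₂, h₂, hr⟩ := x.isCadlag.exists_near_right t₀ (half_pos hε)
  refine ⟨min (ε / 2) (min (1 / 2) (min (δ₁ / 2) (δ₂ / 2))), by positivity, ?_⟩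
  intro z lam hm s hs
  set δ := min (ε / 2) (min (1 / 2) (min (δ₁ / 2) (δ₂ / 2))) with hδ
  have a1 : δ ≤ ε / 2 := min_le_left _ _
  have a2 : δ ≤ 1 / 2 := (min_le_right _ _).trans (min_le_left _ _)
  have a3 : δ ≤ δ₁ / 2 := (min_le_right _ _).trans ((min_le_right _ _).trans (min_le_left _ _))
  have a4 : δ ≤ δ₂ / 2 := (min_le_right _ _).trans ((min_le_right _ _).trans (min_le_right _ _))
  obtain ⟨s', rfl⟩ := lam.surjective s
  have b := abs_lt.1 (hm.time s')
  have b' := abs_lt.1 hs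
  have hs' : s' ≤ t₀ + 1 := by
    rw [← NNReal.coe_le_coe]
    push_cast
    linarith
  have c := hm.space s' hs'
  refine ⟨fun h => ?_, fun h => ?_⟩
  · have := hl s' (lam.lt_iff_lt.1 h) (by linarith)
    have := dist_triangle (z (lam s')) (x s') (leftVal x t₀)
    linarith
  · have := hr s' (lam.le_iff_le.1 h) (by linarith)
    have := dist_triangle (z (lam s')) (x s') (x t₀)
    linarith

theorem eventually_abs_coe_sub_lt (t₀ : ℝ≥0) {δ : ℝ} (hδ : 0 < δ) :
    ∀ᶠ s : ℝ≥0 in 𝓝 t₀, |(s : ℝ) - t₀| < δ := by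
  filter_upwards [Metric.ball_mem_nhds t₀ hδ] with s hs
  rwa [Metric.mem_ball, NNReal.dist_eq] at hs

/-! ### Convergence of the stairs of `xn` to a stair of `x` -/

section Conv

variable {d : ℕ} {xn : ℕ → Cadlag d} {x : Cadlag d}

theorem MatchConv.tendsto_of_continuousAt (hm : MatchConv xn x) {t₀ : ℝ≥0}
    (hc : ContinuousAt x t₀) :
    Tendsto (fun p : ℕ × ℝ≥0 => xn p.1 p.2) (atTop ×ˢ 𝓝 t₀) (𝓝 (x t₀)) := by
  rw [Metric.tendsto_nhds]
  intro ε hε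
  obtain ⟨δ, hδ, h⟩ := exists_near_of_isMatching x t₀ hε
  filter_upwards [(hm (t₀ + 1) δ hδ).prod_inl (𝓝 t₀),
    (eventually_abs_coe_sub_lt t₀ hδ).prod_inr atTop] with p ⟨lam, hlam⟩ hp
  have := h _ lam hlam p.2 hp
  rw [(leftVal_eq_iff_continuousAt x.isCadlag).2 hc] at this
  rcases lt_or_ge p.2 (lam t₀) with h' | h'
  exacts [this.1 h', this.2 h']

theorem InStair.continuousAt {t : ℝ≥0} (h : InStair x t) : ContinuousAt x t := by
  rw [← leftVal_eq_iff_continuousAt x.isCadlag]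
  exact leftVal_of_const h.2.2.2.1 ⟨h.1, (lt_theta_iff h.2.2.1.ne).1 h.2.1⟩

theorem InStair.lt_thetaFin {t : ℝ≥0} (h : InStair x t) : t < thetaFin x t :=
  (lt_theta_iff h.2.2.1.ne).1 h.2.1

/-- If the jumps of `xn` at the times `hn` near the jump time `Θ` of `x` have about the size of
the jump of `x`, then every good matching sends `Θ` to `hn`. -/
theorem eventually_eq_of_jump {Θ : ℝ≥0} (hd : Θ ∈ disc x) {hn : ℕ → ℝ≥0}
    (h1 : Tendsto hn atTop (𝓝 Θ))
    (h2 : Tendsto (fun n => ‖xn n (hn n) - leftVal (xn n) (hn n)‖) atTop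
      (𝓝 ‖x Θ - leftVal x Θ‖)) :
    ∃ δ > (0 : ℝ), ∀ᶠ n in atTop, ∀ lam, IsMatching δ (Θ + 1) lam (xn n) x → hn n = lam Θ := by
  have hpos : 0 < ‖x Θ - leftVal x Θ‖ :=
    norm_pos_iff.2 (sub_ne_zero.2 fun h =>
      hd ((leftVal_eq_iff_continuousAt x.isCadlag).1 h.symm))
  set m := ‖x Θ - leftVal x Θ‖ with hmdef
  obtain ⟨δ, hδ, h⟩ := exists_near_of_isMatching x Θ (show 0 < m / 4 by positivity)
  refine ⟨δ, hδ, ?_⟩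
  filter_upwards [h1.eventually (eventually_abs_coe_sub_lt Θ hδ),
    h2.eventually_const_lt (show m / 2 < m by linarith)] with n hn1 hn2 lam hlam
  have hopen : ∀ᶠ s : ℝ≥0 in 𝓝[<] (hn n), |(s : ℝ) - Θ| < δ := by
    refine Filter.Eventually.filter_mono nhdsWithin_le_nhds ?_
    have hc : Continuous fun s : ℝ≥0 => |(s : ℝ) - Θ| := by fun_prop
    exact (hc.tendsto (hn n)).eventually_lt_const hn1
  -- If both sides of `hn n` were within `m / 4` of one vector, the jump there would be at most `m /
  -- 2`. This happens as soon as `hn n` lies strictly before or strictly after `lam Θ`.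
  have key : ∀ c : Vec d, (∀ᶠ s in 𝓝[<] (hn n), dist (xn n s) c < m / 4) →
      dist (xn n (hn n)) c < m / 4 → False := by
    intro c hc1 hc2
    have h3 := leftVal_mem_of_eventually (xn n).isCadlag (K := Metric.closedBall c (m / 4))
      Metric.isClosed_closedBall (hc1.mono fun s hs => le_of_lt hs) hc2.le
    rw [Metric.mem_closedBall] at h3
    have h4 := dist_triangle_right (xn n (hn n)) (leftVal (xn n) (hn n)) c
    rw [dist_eq_norm] at h4
    linarith
  by_contra hne
  rcases lt_or_gt_of_ne hne with hlt | hgt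
  · refine key (leftVal x Θ) ?_ ((h _ lam hlam _ hn1).1 hlt)
    filter_upwards [hopen, self_mem_nhdsWithin] with s hs hs'
    exact (h _ lam hlam s hs).1 (lt_trans hs' hlt)
  · refine key (x Θ) ?_ ((h _ lam hlam _ hn1).2 hgt.le)
    filter_upwards [hopen, Ioo_mem_nhdsLT hgt] with s hs hs'
    exact (h _ lam hlam s hs).2 hs'.1.le

/-- The stairs of `xn` which approximate a stair of `x`. -/
theorem exists_stair_limits (hm : MatchConv xn x) (hs : StairConv xn x) {t : ℝ≥0}
    (ht : InStair x t) :
    ∃ (e h : ℕ → ℝ≥0) (c v : ℕ → Vec d), Tendsto e atTop (𝓝 (eta x t)) ∧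
      Tendsto h atTop (𝓝 (thetaFin x t)) ∧ Tendsto c atTop (𝓝 (x t)) ∧
      Tendsto v atTop (𝓝 (x (thetaFin x t))) ∧
      (∀ᶠ n in atTop, ∀ s, e n ≤ s → s ≤ h n →
        stairFun (xn n) s = c n + (((s : ℝ) - e n) / ((h n : ℝ) - e n)) • (v n - c n)) ∧
      (∀ n, ∀ s < e n, theta (xn n) s ≤ e n) ∧
      ∃ δ > (0 : ℝ), ∀ᶠ n in atTop, ∀ lam,
        IsMatching δ (thetaFin x t + 1) lam (xn n) x → h n = lam (thetaFin x t) := by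
  obtain ⟨tn, h1, h2, h3, h4⟩ := hs t ht
  have hfin : theta x t ≠ ⊤ := ht.2.2.1.ne
  have h5 : Tendsto (fun n => thetaFin (xn n) (tn n)) atTop (𝓝 (thetaFin x t)) :=
    (ENNReal.tendsto_toNNReal hfin).comp h3
  obtain ⟨δ, hδ, hev⟩ := eventually_eq_of_jump ht.2.2.2.2 h5 h4
  refine ⟨_, _, fun n => xn n (tn n), fun n => xn n (thetaFin (xn n) (tn n)), h2, h5,
    (hm.tendsto_of_continuousAt ht.continuousAt).comp (tendsto_id.prodMk h1), ?_, ?_, ?_,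
    δ, hδ, hev⟩
  · rw [Metric.tendsto_nhds]
    intro ε hε
    -- The height at the end of the stair converges only because that end is exactly `lam Θ`; on the
    -- wrong side of `lam Θ` the value would be near `x(Θ-)`.
    filter_upwards [hev, hm (thetaFin x t + 1) (min δ ε) (lt_min hδ hε)] with n hn ⟨lam, hlam⟩
    rw [hn lam (hlam.mono (min_le_left _ _) le_rfl)]
    exact (hlam.space _ le_self_add).trans_le (min_le_right _ _)
  · filter_upwards [h2.eventually_lt h1 ht.1, (ENNReal.tendsto_coe.2 h1).eventually_lt h3 ht.2.1,
      h3.eventually_lt_const ht.2.2.1] with n a1 a2 a3 s b1 b2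
    exact stairFun_eq_of_mem_stair (xn n).isCadlag a1 a2 a3.ne b1 b2
  · exact fun n s hs => theta_le_eta (xn n).isCadlag hs

theorem tendsto_affine {α : Type*} {F : Filter α} {s e h : α → ℝ≥0} {c v : α → Vec d}
    {s₀ e₀ h₀ : ℝ≥0} {c₀ v₀ : Vec d} (hs : Tendsto s F (𝓝 s₀)) (he : Tendsto e F (𝓝 e₀))
    (hh : Tendsto h F (𝓝 h₀)) (hc : Tendsto c F (𝓝 c₀)) (hv : Tendsto v F (𝓝 v₀))
    (hlt : e₀ < h₀) :
    Tendsto (fun a => c a + (((s a : ℝ) - e a) / ((h a : ℝ) - e a)) • (v a - c a)) F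
      (𝓝 (c₀ + (((s₀ : ℝ) - e₀) / ((h₀ : ℝ) - e₀)) • (v₀ - c₀))) := by
  have hlt' : (e₀ : ℝ) < h₀ := hlt
  have hco := NNReal.continuous_coe
  have hs' := (hco.tendsto _).comp hs
  have he' := (hco.tendsto _).comp he
  have hh' := (hco.tendsto _).comp hh
  exact hc.add (((hs'.sub he').div (hh'.sub he') (by linarith)).smul (hv.sub hc))

theorem tendsto_stairFun_of_inStair (hm : MatchConv xn x) (hs : StairConv xn x) {t₀ : ℝ≥0}
    (ht : InStair x t₀) :
    Tendsto (fun p : ℕ × ℝ≥0 => stairFun (xn p.1) p.2) (atTop ×ˢ 𝓝 t₀) (𝓝 (stairFun x t₀)) := by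
  obtain ⟨e, h, c, v, he, hh, hc, hv, hform, -, -⟩ := exists_stair_limits hm hs ht
  rw [stairFun_eq_of_mem_stair x.isCadlag ht.1 ht.2.1 ht.2.2.1.ne ht.1.le ht.lt_thetaFin.le]
  have key := tendsto_affine (tendsto_snd (f := atTop) (g := 𝓝 t₀)) (he.comp tendsto_fst)
    (hh.comp tendsto_fst) (hc.comp tendsto_fst) (hv.comp tendsto_fst)
    (ht.1.trans ht.lt_thetaFin)
  refine key.congr' ?_
  filter_upwards [hform.prod_inl (𝓝 t₀),
    (he.comp tendsto_fst).eventually_lt tendsto_snd ht.1,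
    tendsto_snd.eventually_lt (hh.comp tendsto_fst) ht.lt_thetaFin] with p hp h1 h2
  exact (hp p.2 (le_of_lt h1) (le_of_lt h2)).symm

end Conv

/-! ### Joint convergence of `f(xn)(s)` as `n → ∞`, `s → t₀` -/

section Conv

variable {d : ℕ} {xn : ℕ → Cadlag d} {x : Cadlag d}

theorem stairFun_mem_ball_of_theta_lt {z : ℝ≥0 → Vec d} (hz : IsCadlag z) {t v : ℝ≥0}
    {c : Vec d} {ε : ℝ} (hθ : theta z t < v) (h : ∀ s, t ≤ s → s < v → dist (z s) c < ε) :
    dist (stairFun z t) c < ε := by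
  have hfin : theta z t ≠ ⊤ := ne_top_of_lt hθ
  have hle := le_thetaFin hfin
  rw [← coe_thetaFin hfin, ENNReal.coe_lt_coe] at hθ
  exact (convex_ball c ε).segment_subset (h t le_rfl (hle.trans_lt hθ)) (h _ hle hθ)
    (stairFun_mem_segment hz hfin)

/-- The matched times of `w₁` and `w₂` carry different values of `xn`, so a stair of `xn` met near
`t₀` must end by the later of them. The function `x` stays close to `x t₀` up to there, hence so
does `xn` at the end of the stair. -/
theorem eventually_stairFun_near_of_exists_ne (hm : MatchConv xn x) {t₀ : ℝ≥0} {ε : ℝ}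
    (hε : 0 < ε) {w₁ w₂ v : ℝ≥0} (h₁ : t₀ < w₁) (h₂ : t₀ < w₂) (hne : x w₁ ≠ x w₂)
    (hnear : ∀ s, t₀ ≤ s → s ≤ max w₁ w₂ → dist (x s) (x t₀) < ε / 2) (hv : t₀ < v) :
    ∀ᶠ p : ℕ × ℝ≥0 in atTop ×ˢ 𝓝 t₀,
      (∀ s, p.2 ≤ s → s < v → dist (xn p.1 s) (x t₀) < ε) →
        dist (stairFun (xn p.1) p.2) (x t₀) < ε := by
  set m := min (min w₁ w₂) v with hmdef
  have hm0 : (t₀ : ℝ) < m := NNReal.coe_lt_coe.2 (lt_min (lt_min h₁ h₂) hv)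
  have hm1 : (m : ℝ) ≤ w₁ := NNReal.coe_le_coe.2 ((min_le_left _ _).trans (min_le_left _ _))
  have hm2 : (m : ℝ) ≤ w₂ := NNReal.coe_le_coe.2 ((min_le_left _ _).trans (min_le_right _ _))
  have hmv : (m : ℝ) ≤ v := NNReal.coe_le_coe.2 (min_le_right _ _)
  have hdist := dist_pos.2 hne
  have hgap : 0 < ((m : ℝ) - t₀) / 2 := by linarith
  set δ := min (ε / 2) (min (dist (x w₁) (x w₂) / 2) (((m : ℝ) - t₀) / 2)) with hδdef
  have hδ : 0 < δ := lt_min (half_pos hε) (lt_min (half_pos hdist) hgap)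
  have a1 : δ ≤ ε / 2 := min_le_left _ _
  have a2 : δ ≤ dist (x w₁) (x w₂) / 2 := (min_le_right _ _).trans (min_le_left _ _)
  have a3 : δ ≤ ((m : ℝ) - t₀) / 2 := (min_le_right _ _).trans (min_le_right _ _)
  filter_upwards [(hm (max w₁ w₂) δ hδ).prod_inl (𝓝 t₀),
    (eventually_abs_coe_sub_lt t₀ hgap).prod_inr atTop] with p ⟨lam, hlam⟩ hp hball
  have hp' := abs_lt.1 hp
  have b1 := abs_lt.1 (hlam.time w₁)
  have b2 := abs_lt.1 (hlam.time w₂)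
  have l1 : p.2 ≤ lam w₁ := by
    rw [← NNReal.coe_le_coe]
    linarith
  have l2 : p.2 ≤ lam w₂ := by
    rw [← NNReal.coe_le_coe]
    linarith
  have hne' : xn p.1 (lam w₁) ≠ xn p.1 (lam w₂) := by
    intro heq
    have c1 := hlam.space w₁ (le_max_left _ _)
    have c2 := hlam.space w₂ (le_max_right _ _)
    rw [heq] at c1
    have := dist_triangle_left (x w₁) (x w₂) (xn p.1 (lam w₂))
    linarith
  have hθ := theta_le_max l1 l2 hne'
  rw [← lam.monotone.map_max] at hθ
  have hfin : theta (xn p.1) p.2 ≠ ⊤ := ne_top_of_le_ne_top ENNReal.coe_ne_top hθ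
  rcases lt_or_ge (theta (xn p.1) p.2) v with hlt | hge
  · exact stairFun_mem_ball_of_theta_lt (xn p.1).isCadlag hlt hball
  · rw [← coe_thetaFin hfin, ENNReal.coe_le_coe] at hge hθ
    have hpv : p.2 < v := by
      rw [← NNReal.coe_lt_coe]
      linarith
    refine (convex_ball (x t₀) ε).segment_subset (hball _ le_rfl hpv) ?_
      (stairFun_mem_segment (xn p.1).isCadlag hfin)
    -- The stair ends beyond the region where `xn` is assumed close. Its end is matched to some `q`
    -- between `t₀` and `max w₁ w₂`; the choice of the gap `(m - t₀) / 2` ensures `t₀ ≤ q`.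
    obtain ⟨q, hq⟩ := lam.surjective (thetaFin (xn p.1) p.2)
    rw [← hq] at hge hθ ⊢
    have hq1 : q ≤ max w₁ w₂ := lam.le_iff_le.1 hθ
    have b3 := abs_lt.1 (hlam.time q)
    have hq2 : t₀ ≤ q := by
      have : (v : ℝ) ≤ lam q := hge
      rw [← NNReal.coe_le_coe]
      linarith
    have c1 := hlam.space q hq1
    have c2 := hnear q hq2 hq1
    have := dist_triangle (xn p.1 (lam q)) (x q) (x t₀)
    rw [Metric.mem_ball]
    linarith

/-- Away from the interior of the stairs of `x`, the values of `stairFun (xn n)` near `t₀` are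
controlled by the values of `xn n` to the right. -/
theorem eventually_stairFun_near (hm : MatchConv xn x) (hs : StairConv xn x)
    (hfin : ∀ t, theta x t < ⊤) {t₀ : ℝ≥0} (hn : ¬ InStair x t₀) {ε : ℝ} (hε : 0 < ε)
    {v : ℝ≥0} (hv : t₀ < v) :
    ∀ᶠ p : ℕ × ℝ≥0 in atTop ×ˢ 𝓝 t₀,
      (∀ s, p.2 ≤ s → s < v → dist (xn p.1 s) (x t₀) < ε) →
        dist (stairFun (xn p.1) p.2) (x t₀) < ε := by
  have hx := x.isCadlag
  by_cases hc : ∃ b > t₀, ConstOn x (Ioo t₀ b)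
  · obtain ⟨b, hb, hc⟩ := hc
    obtain ⟨t₁, ht₁⟩ := exists_between hb
    have hη : eta x t₁ ≤ t₀ := eta_le_of_const hc ht₁
    have hfin₁ := (hfin t₁).ne
    have hθ : (t₁ : ℝ≥0∞) < theta x t₁ :=
      lt_of_lt_of_le (by exact_mod_cast ht₁.2) (le_theta_of_const hc ht₁)
    have hθ' : t₁ < thetaFin x t₁ := (lt_theta_iff hfin₁).1 hθ
    have hval : ∀ s, t₀ ≤ s → s < thetaFin x t₁ → x s = x t₁ := fun s h1 h2 =>
      apply_eq_of_mem_stair hx (hη.trans h1) ((lt_theta_iff hfin₁).2 h2)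
    have ht₀ := hval t₀ le_rfl (ht₁.1.trans hθ')
    by_cases hd : thetaFin x t₁ ∈ disc x
    · have hst : InStair x t₁ :=
        ⟨hη.trans_lt ht₁.1, hθ, hfin t₁, constOn_stair x hfin₁, hd⟩
      have hη0 : eta x t₁ = t₀ := by
        refine hη.eq_of_not_lt fun hlt => hn ?_
        have hcs := constOn_stair x hfin₁
        have m1 : t₁ ∈ Ioo (eta x t₁) (thetaFin x t₁) := ⟨hst.1, hθ'⟩
        have m0 : t₀ ∈ Ioo (eta x t₁) (thetaFin x t₁) := ⟨hlt, ht₁.1.trans hθ'⟩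
        have e1 := eta_eq_of_const hcs m0 m1
        have e2 := theta_eq_of_const hcs m0 m1
        refine ⟨by rwa [e1], ?_, hfin t₀, constOn_stair x (hfin t₀).ne, ?_⟩
        · rw [e2, lt_theta_iff hfin₁]
          exact m0.2
        · rwa [thetaFin, e2]
      obtain ⟨e, h, c, w, he, hh, hcc, hw, hform, hle, -⟩ := exists_stair_limits hm hs hst
      rw [hη0] at he
      have hlt : t₀ < thetaFin x t₁ := ht₁.1.trans hθ'
      have key := tendsto_affine (tendsto_snd (f := atTop) (g := 𝓝 t₀)) (he.comp tendsto_fst)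
        (hh.comp tendsto_fst) (hcc.comp tendsto_fst) (hw.comp tendsto_fst) hlt
      rw [sub_self, zero_div, zero_smul, add_zero, ← ht₀] at key
      filter_upwards [hform.prod_inl (𝓝 t₀), key (Metric.ball_mem_nhds _ hε),
        tendsto_snd.eventually_lt (hh.comp tendsto_fst) hlt,
        (he.eventually_lt_const hv).prod_inl (𝓝 t₀)] with p hp1 hp2 hp3 hp4 hball
      -- From `e` on, the interpolation along the approximating stair applies. Before `e`, any stair
      -- of `xn` ends by `e < v`, hence inside the controlled region.
      rcases le_or_gt (e p.1) p.2 with h1 | h1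
      · rw [hp1 p.2 h1 (le_of_lt hp3)]
        exact hp2
      · exact stairFun_mem_ball_of_theta_lt (xn p.1).isCadlag
          ((hle p.1 p.2 h1).trans_lt (by exact_mod_cast hp4)) hball
    -- The constancy interval ends without a jump, so shortly after it `x` takes a value different
    -- from, but close to, `x t₀`.
    · have hcont : leftVal x (thetaFin x t₁) = x (thetaFin x t₁) :=
        (leftVal_eq_iff_continuousAt hx).2 (not_not.1 hd)
      rw [leftVal_thetaFin hx hθ hfin₁, ← ht₀] at hcont
      obtain ⟨δ, hδ, hnear⟩ := hx.exists_near_right (thetaFin x t₁) (half_pos hε)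
      have hlt : thetaFin x t₁ < thetaFin x t₁ + δ.toNNReal :=
        lt_add_of_pos_right _ (Real.toNNReal_pos.2 hδ)
      obtain ⟨w, hw1, hw2, hw3⟩ := exists_ne_near_thetaFin hθ hfin₁ hlt
      refine eventually_stairFun_near_of_exists_ne hm hε ht₁.1 (ht₁.1.trans (hθ'.trans_le hw1))
        hw3.symm (fun s h1 h2 => ?_) hv
      rw [max_eq_right (hθ'.le.trans hw1)] at h2
      rcases lt_or_ge s (thetaFin x t₁) with h3 | h3
      · rw [hval s h1 h3, ht₀, dist_self]
        exact half_pos hε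
      · rw [hcont]
        refine hnear s h3 ?_
        have : ((s : ℝ≥0) : ℝ) < (thetaFin x t₁ + δ.toNNReal : ℝ≥0) := h2.trans_lt hw2
        rwa [NNReal.coe_add, Real.coe_toNNReal _ hδ.le] at this
  · push Not at hc
    obtain ⟨δ, hδ, hnear⟩ := hx.exists_near_right t₀ (half_pos hε)
    have hlt : t₀ < t₀ + δ.toNNReal := lt_add_of_pos_right _ (Real.toNNReal_pos.2 hδ)
    have h2 := hc _ hlt
    simp only [ConstOn, not_forall] at h2
    obtain ⟨p, hp, q, hq, hpq⟩ := h2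
    refine eventually_stairFun_near_of_exists_ne hm hε hp.1 hq.1 hpq (fun s h1 h2 => ?_) hv
    refine hnear s h1 ?_
    have : ((s : ℝ≥0) : ℝ) < (t₀ + δ.toNNReal : ℝ≥0) := h2.trans_lt (max_lt hp.2 hq.2)
    rwa [NNReal.coe_add, Real.coe_toNNReal _ hδ.le] at this

theorem tendsto_stairFun_of_continuousAt (hm : MatchConv xn x) (hs : StairConv xn x)
    (hfin : ∀ t, theta x t < ⊤) {t₀ : ℝ≥0} (hc : ContinuousAt x t₀) :
    Tendsto (fun p : ℕ × ℝ≥0 => stairFun (xn p.1) p.2) (atTop ×ˢ 𝓝 t₀) (𝓝 (stairFun x t₀)) := by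
  by_cases hn : InStair x t₀
  · exact tendsto_stairFun_of_inStair hm hs hn
  rw [stairFun_of_not_inStair (hfin t₀) hn, Metric.tendsto_nhds]
  intro ε hε
  have h1 : ∀ᶠ p : ℕ × ℝ≥0 in atTop ×ˢ 𝓝 t₀, dist (xn p.1 p.2) (x t₀) < ε :=
    hm.tendsto_of_continuousAt hc (Metric.ball_mem_nhds _ hε)
  obtain ⟨P, hP, Q, hQ, hPQ⟩ := eventually_prod_iff.1 h1
  obtain ⟨δ, hδ, hball⟩ := Metric.eventually_nhds_iff.1 hQ
  have hδ' : t₀ < t₀ + δ.toNNReal := lt_add_of_pos_right _ (Real.toNNReal_pos.2 hδ)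
  filter_upwards [eventually_stairFun_near hm hs hfin hn hε hδ', hP.prod_inl (𝓝 t₀),
    (eventually_abs_coe_sub_lt t₀ hδ).prod_inr atTop] with p h2 h3 h4
  refine h2 fun s h5 h6 => ?_
  refine hPQ h3 (y := s) (hball ?_)
  have h7 : ((s : ℝ≥0) : ℝ) < (t₀ + δ.toNNReal : ℝ≥0) := h6
  rw [NNReal.coe_add, Real.coe_toNNReal _ hδ.le] at h7
  have h8 : (p.2 : ℝ) ≤ s := h5
  have h9 := abs_lt.1 h4
  rw [NNReal.dist_eq, abs_lt]
  constructor <;> linarith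

/-- The case of a jump at the end of a stair. -/
theorem tendsto_stairFun_of_constOn_left (hm : MatchConv xn x) (hs : StairConv xn x)
    (hfin : ∀ t, theta x t < ⊤) {t₀ a : ℝ≥0} (hd : ¬ ContinuousAt x t₀) (ha : a < t₀)
    (hc : ConstOn x (Ioo a t₀)) :
    Tendsto (fun p : ℕ × ℝ≥0 => stairFun (xn p.1) p.2) (atTop ×ˢ 𝓝 t₀) (𝓝 (stairFun x t₀)) := by
  have hx := x.isCadlag
  obtain ⟨t₁, ht₁⟩ := exists_between ha
  have hn : ¬ InStair x t₀ := fun h => hd h.continuousAt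
  have hfin₁ := (hfin t₁).ne
  have hl : leftVal x t₀ = x t₁ :=
    leftVal_eq_of_eqOn hx ha fun s h1 h2 => hc s ⟨h1, h2⟩ t₁ ht₁
  have hne : x t₁ ≠ x t₀ := fun h => hd ((leftVal_eq_iff_continuousAt hx).1 (hl.trans h))
  have hθ : theta x t₁ = t₀ :=
    le_antisymm (theta_le_of_ne ht₁.2.le hne) (le_theta_of_const hc ht₁)
  have hθ' : thetaFin x t₁ = t₀ := by rw [thetaFin, hθ, ENNReal.toNNReal_coe]
  have hη : eta x t₁ < t₁ := (eta_le_of_const hc ht₁).trans_lt ht₁.1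
  have hst : InStair x t₁ := ⟨hη, by rw [hθ]; exact_mod_cast ht₁.2, hfin t₁,
    constOn_stair x hfin₁, by rw [hθ']; exact hd⟩
  obtain ⟨e, h, c, w, he, hh, hcc, hw, hform, -, δ₁, hδ₁, heq⟩ := exists_stair_limits hm hs hst
  rw [hθ'] at hh hw heq
  have hlt : eta x t₁ < t₀ := hη.trans ht₁.2
  have key := tendsto_affine (tendsto_snd (f := atTop) (g := 𝓝 t₀)) (he.comp tendsto_fst)
    (hh.comp tendsto_fst) (hcc.comp tendsto_fst) (hw.comp tendsto_fst) hlt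
  have hlt' : (eta x t₁ : ℝ) < t₀ := hlt
  rw [div_self (by linarith), one_smul, add_sub_cancel] at key
  rw [stairFun_of_not_inStair (hfin t₀) hn, Metric.tendsto_nhds]
  intro ε hε
  obtain ⟨δ₂, hδ₂, hnear⟩ := exists_near_of_isMatching x t₀ hε
  have hδ' : t₀ < t₀ + δ₂.toNNReal := lt_add_of_pos_right _ (Real.toNNReal_pos.2 hδ₂)
  filter_upwards [hform.prod_inl (𝓝 t₀), key (Metric.ball_mem_nhds _ hε),
    (he.comp tendsto_fst).eventually_lt tendsto_snd hlt, heq.prod_inl (𝓝 t₀),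
    (hm (t₀ + 1) (min δ₁ δ₂) (lt_min hδ₁ hδ₂)).prod_inl (𝓝 t₀),
    (eventually_abs_coe_sub_lt t₀ hδ₂).prod_inr atTop,
    eventually_stairFun_near hm hs hfin hn hε hδ'] with p h1 h2 h3 h4 ⟨lam, hlam⟩ h5 h6
  -- Up to its end the approximating stair gives the value. After it, `h = lam t₀` means that `xn`
  -- has already made its jump and is close to `x t₀`.
  rcases le_or_gt p.2 (h p.1) with h7 | h7
  · rw [h1 p.2 (le_of_lt h3) h7]
    exact h2
  · refine h6 fun s h8 h9 => (hnear _ lam (hlam.mono (min_le_right _ _) le_rfl) s ?_).2 ?_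
    · have h10 : ((s : ℝ≥0) : ℝ) < (t₀ + δ₂.toNNReal : ℝ≥0) := h9
      rw [NNReal.coe_add, Real.coe_toNNReal _ hδ₂.le] at h10
      have h11 : (p.2 : ℝ) ≤ s := h8
      have h12 := abs_lt.1 h5
      rw [abs_lt]
      constructor <;> linarith
    · rw [← h4 lam (hlam.mono (min_le_left _ _) le_rfl)]
      exact h7.le.trans h8

end Conv

/-! ### Completed graphs that follow a segment -/

/-- The part of the completed graph of `z` from `(z s, s)` up to time `u`. -/
def graphWindow {d : ℕ} (z : Cadlag d) (s u : ℝ≥0) : Set (Vec d × ℝ≥0) :=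
  {p | p = (z s, s) ∨ (s < p.2 ∧ p.2 ≤ u ∧ p.1 ∈ segment ℝ (leftVal z p.2) (z p.2))}

/-- Between the times `s` and `u`, the completed graph of `z` runs monotonically along the segment
from `l` to `r`, up to `ε`. -/
def TracksSegment {d : ℕ} (z : Cadlag d) (s u : ℝ≥0) (l r : Vec d) (ε : ℝ) : Prop :=
  ∃ κ : Vec d × ℝ≥0 → ℝ,
    (∀ p ∈ graphWindow z s u, ∀ q ∈ graphWindow z s u, graphLE z p q → κ p ≤ κ q) ∧
    κ (z s, s) = 0 ∧ κ (z u, u) = 1 ∧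
    (∀ c ∈ Icc (0 : ℝ) 1, ∃ p ∈ graphWindow z s u, κ p = c) ∧
    ∀ p ∈ graphWindow z s u, ‖p.1 - (l + κ p • (r - l))‖ ≤ ε

section Tracks

variable {d : ℕ} {z : Cadlag d} {s u : ℝ≥0} {l r : Vec d} {ε : ℝ}

theorem TracksSegment.mono {ε' : ℝ} (h : TracksSegment z s u l r ε) (hε : ε ≤ ε') :
    TracksSegment z s u l r ε' := by
  obtain ⟨κ, h1, h2, h3, h4, h5⟩ := h
  exact ⟨κ, h1, h2, h3, h4, fun p hp => (h5 p hp).trans hε⟩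

theorem mem_graphWindow {t : ℝ≥0} (h1 : s ≤ t) (h2 : t ≤ u) : (z t, t) ∈ graphWindow z s u := by
  rcases h1.eq_or_lt with rfl | h1
  · exact Or.inl rfl
  · exact Or.inr ⟨h1, h2, right_mem_segment _ _ _⟩

theorem norm_interpolate_sub_le {a b l r : Vec d} {c ε : ℝ} (hc : c ∈ Icc (0 : ℝ) 1)
    (ha : ‖a - l‖ ≤ ε) (hb : ‖b - r‖ ≤ ε) :
    ‖a + c • (b - a) - (l + c • (r - l))‖ ≤ ε := by
  have : a + c • (b - a) - (l + c • (r - l)) = (1 - c) • (a - l) + c • (b - r) := by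
    module
  rw [this]
  refine (norm_add_le _ _).trans ?_
  rw [norm_smul, norm_smul, Real.norm_of_nonneg hc.1, Real.norm_of_nonneg (sub_nonneg.2 hc.2)]
  calc (1 - c) * ‖a - l‖ + c * ‖b - r‖ ≤ (1 - c) * ε + c * ε :=
        add_le_add (mul_le_mul_of_nonneg_left ha (sub_nonneg.2 hc.2))
          (mul_le_mul_of_nonneg_left hb hc.1)
    _ = ε := by ring

theorem tracksSegment_of_continuous (hsu : s ≤ u) {κ : ℝ≥0 → ℝ} (hκ : Continuous κ)
    (hmono : Monotone κ) (h0 : κ s = 0) (h1 : κ u = 1)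
    (h : ∀ t, s ≤ t → t ≤ u → ‖z t - (l + κ t • (r - l))‖ ≤ ε) :
    TracksSegment z s u l r ε := by
  refine ⟨fun p => κ p.2, ?_, h0, h1, ?_, ?_⟩
  · rintro p - q - (hpq | hpq)
    · exact hmono hpq.le
    · exact hmono hpq.1.le
  · intro c hc
    obtain ⟨t, ht, htc⟩ := intermediate_value_Icc hsu hκ.continuousOn (h0 ▸ h1 ▸ hc)
    exact ⟨(z t, t), mem_graphWindow ht.1 ht.2, htc⟩
  · rintro p (rfl | ⟨h2, h3, h4⟩)
    · exact h s le_rfl hsu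
    · have hb : z p.2 ∈ Metric.closedBall (l + κ p.2 • (r - l)) ε := by
        rw [mem_closedBall_iff_norm]
        exact h _ h2.le h3
      have ha : leftVal z p.2 ∈ Metric.closedBall (l + κ p.2 • (r - l)) ε := by
        rw [mem_closedBall_iff_norm]
        have : (𝓝[<] p.2).NeBot := nhdsLT_neBot_of_exists_lt ⟨s, h2⟩
        have hg : Continuous fun t => l + κ t • (r - l) := by fun_prop
        have ht := ((z.isCadlag.tendsto_leftVal p.2).sub
          ((hg.tendsto p.2).mono_left nhdsWithin_le_nhds)).norm
        refine le_of_tendsto ht ?_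
        filter_upwards [Ioo_mem_nhdsLT h2] with t ht'
        exact h t ht'.1.le (ht'.2.le.trans h3)
      exact mem_closedBall_iff_norm.1 ((convex_closedBall _ _).segment_subset ha hb h4)

theorem tracksSegment_of_near (hsu : s < u) {v : Vec d}
    (h : ∀ t, s ≤ t → t ≤ u → ‖z t - v‖ ≤ ε) : TracksSegment z s u v v ε := by
  have hlt : (s : ℝ) < u := hsu
  refine tracksSegment_of_continuous hsu.le (κ := fun t => ((t : ℝ) - s) / ((u : ℝ) - s))
    (by fun_prop) (fun a b hab => ?_) (by simp) (div_self (by linarith)) fun t h1 h2 => ?_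
  · have : (a : ℝ) ≤ b := hab
    exact div_le_div_of_nonneg_right (by linarith) (by linarith)
  · simpa using h t h1 h2

theorem tracksSegment_of_affine {a b : ℝ≥0} (hsa : s ≤ a) (hab : a < b) (hbu : b ≤ u)
    {c w : Vec d} (hl : ∀ t, s ≤ t → t < a → ‖z t - l‖ ≤ ε)
    (hab' : ∀ t, a ≤ t → t ≤ b → z t = c + (((t : ℝ) - a) / ((b : ℝ) - a)) • (w - c))
    (hr : ∀ t, b ≤ t → t ≤ u → ‖z t - r‖ ≤ ε) (hc : ‖c - l‖ ≤ ε) (hw : ‖w - r‖ ≤ ε) :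
    TracksSegment z s u l r ε := by
  have hlt : (a : ℝ) < b := hab
  have hpos : 0 < (b : ℝ) - a := by linarith
  have k0 : ∀ t : ℝ≥0, t ≤ a → max 0 (min 1 (((t : ℝ) - a) / ((b : ℝ) - a))) = 0 := by
    intro t ht
    have : (t : ℝ) ≤ a := ht
    exact max_eq_left ((min_le_right _ _).trans
      (div_nonpos_of_nonpos_of_nonneg (by linarith) hpos.le))
  have k1 : ∀ t : ℝ≥0, b ≤ t → max 0 (min 1 (((t : ℝ) - a) / ((b : ℝ) - a))) = 1 := by
    intro t ht
    have : (b : ℝ) ≤ t := ht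
    rw [min_eq_left ((one_le_div hpos).2 (by linarith)), max_eq_right zero_le_one]
  refine tracksSegment_of_continuous (hsa.trans (hab.le.trans hbu))
    (κ := fun t => max 0 (min 1 (((t : ℝ) - a) / ((b : ℝ) - a))))
    (by fun_prop) (fun p q hpq => ?_) (k0 s hsa) (k1 u hbu) fun t h1 h2 => ?_
  · have : (p : ℝ) ≤ q := hpq
    exact max_le_max le_rfl (min_le_min le_rfl
      (div_le_div_of_nonneg_right (by linarith) hpos.le))
  · rcases lt_or_ge t a with hta | hta
    · rw [k0 t hta.le, zero_smul, add_zero]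
      exact hl t h1 hta
    rcases le_or_gt b t with htb | htb
    · rw [k1 t htb, one_smul, add_sub_cancel]
      exact hr t htb h2
    · have g1 : (a : ℝ) ≤ t := hta
      have g2 : (t : ℝ) ≤ b := htb.le
      have hm : ((t : ℝ) - a) / ((b : ℝ) - a) ∈ Icc (0 : ℝ) 1 :=
        ⟨div_nonneg (by linarith) hpos.le, div_le_one_of_le₀ (by linarith) hpos.le⟩
      rw [hab' t hta htb.le, min_eq_right hm.2, max_eq_right hm.1]
      exact norm_interpolate_sub_le hm hc hw

/-- Time alone cannot measure progress here, since the whole segment is crossed at time `b`.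
Progress at `b` is therefore the relative distance to the left limit, which is exactly what orders
the completed graph there. -/
theorem tracksSegment_of_jump {b : ℝ≥0} (hsb : s < b) (hbu : b ≤ u)
    (hl : ∀ t, s ≤ t → t < b → ‖z t - l‖ ≤ ε) (hr : ∀ t, b ≤ t → t ≤ u → ‖z t - r‖ ≤ ε)
    (hne : leftVal z b ≠ z b) : TracksSegment z s u l r ε := by
  classical
  have hz := z.isCadlag
  have hl' : ∀ t, s < t → t ≤ b → leftVal z t ∈ Metric.closedBall l ε := fun t h1 h2 =>
    leftVal_mem_of_isClosed hz h1 Metric.isClosed_closedBall fun t' h3 h4 =>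
      mem_closedBall_iff_norm.2 (hl t' h3.le (h4.trans_le h2))
  have hr' : ∀ t, b < t → t ≤ u → leftVal z t ∈ Metric.closedBall r ε := fun t h1 h2 =>
    leftVal_mem_of_isClosed hz h1 Metric.isClosed_closedBall fun t' h3 h4 =>
      mem_closedBall_iff_norm.2 (hr t' h3.le (h4.le.trans h2))
  have hpos : 0 < ‖leftVal z b - z b‖ := norm_pos_iff.2 (sub_ne_zero.2 hne)
  let κ : Vec d × ℝ≥0 → ℝ := fun p => if p.2 < b then 0 else if p.2 = b then
    ‖leftVal z b - p.1‖ / ‖leftVal z b - z b‖ else 1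
  have kl : ∀ p, p.2 < b → κ p = 0 := fun p hp => if_pos hp
  have kr : ∀ p, b < p.2 → κ p = 1 := fun p hp => by
    simp only [κ, if_neg hp.not_gt, if_neg hp.ne']
  have kb : ∀ p, p.2 = b → κ p = ‖leftVal z b - p.1‖ / ‖leftVal z b - z b‖ := fun p hp => by
    simp only [κ, hp, lt_irrefl, if_false, if_true]
  have kc : ∀ c ∈ Icc (0 : ℝ) 1, κ (leftVal z b + c • (z b - leftVal z b), b) = c := by
    intro c hc
    rw [kb _ rfl]
    dsimp only
    rw [sub_add_cancel_left, norm_neg, norm_smul, Real.norm_of_nonneg hc.1, norm_sub_rev (z b),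
      mul_div_cancel_right₀ _ hpos.ne']
  have kseg : ∀ p ∈ graphWindow z s u, p.2 = b →
      ∃ c ∈ Icc (0 : ℝ) 1, p.1 = leftVal z b + c • (z b - leftVal z b) ∧ κ p = c := by
    rintro ⟨y, t⟩ hp (rfl : t = b)
    rcases hp with hp | ⟨-, -, hp⟩
    · exact absurd (congrArg Prod.snd hp) hsb.ne'
    · dsimp only at hp
      rw [segment_eq_image'] at hp
      obtain ⟨c, hc, rfl⟩ := hp
      exact ⟨c, hc, rfl, kc c hc⟩
  have k01 : ∀ p ∈ graphWindow z s u, κ p ∈ Icc (0 : ℝ) 1 := by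
    intro p hp
    rcases lt_trichotomy p.2 b with h | h | h
    · rw [kl p h]
      exact ⟨le_rfl, zero_le_one⟩
    · obtain ⟨c, hc, -, h2⟩ := kseg p hp h
      rwa [h2]
    · rw [kr p h]
      exact ⟨zero_le_one, le_rfl⟩
  refine ⟨κ, ?_, kl _ hsb, ?_, ?_, ?_⟩
  · rintro p hp q hq (h | ⟨h, h'⟩)
    · rcases lt_or_ge p.2 b with h1 | h1
      · rw [kl p h1]
        exact (k01 q hq).1
      · rw [kr q (h1.trans_lt h)]
        exact (k01 p hp).2
    · rcases lt_trichotomy p.2 b with h1 | h1 | h1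
      · rw [kl p h1, kl q (h ▸ h1)]
      · rw [kb p h1, kb q (h ▸ h1)]
        rw [h1] at h'
        exact div_le_div_of_nonneg_right h' hpos.le
      · rw [kr p h1, kr q (h ▸ h1)]
  · rcases hbu.eq_or_lt with rfl | h
    · rw [kb _ rfl, div_self hpos.ne']
    · exact kr _ h
  · intro c hc
    refine ⟨_, Or.inr ⟨hsb, hbu, ?_⟩, kc c hc⟩
    rw [segment_eq_image']
    exact ⟨c, hc, rfl⟩
  · intro p hp
    rcases lt_trichotomy p.2 b with h | h | h
    · rw [kl p h, zero_smul, add_zero]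
      rcases hp with rfl | ⟨h1, h2, h3⟩
      · exact hl s le_rfl hsb
      · exact mem_closedBall_iff_norm.1 ((convex_closedBall l ε).segment_subset (hl' _ h1 h.le)
          (mem_closedBall_iff_norm.2 (hl _ h1.le h)) h3)
    · obtain ⟨c, hc, h1, h2⟩ := kseg p hp h
      rw [h1, h2]
      exact norm_interpolate_sub_le hc (mem_closedBall_iff_norm.1 (hl' b hsb le_rfl))
        (hr b le_rfl hbu)
    · rw [kr p h, one_smul, add_sub_cancel]
      rcases hp with rfl | ⟨h1, h2, h3⟩
      · exact absurd hsb h.not_gt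
      · exact mem_closedBall_iff_norm.1 ((convex_closedBall r ε).segment_subset (hr' _ h h2)
          (mem_closedBall_iff_norm.2 (hr _ h.le h2)) h3)

end Tracks

/-! ### Local tracking, including jumps not preceded by a stair -/

section Conv

variable {d : ℕ} {xn : ℕ → Cadlag d} {x : Cadlag d}

/-- The case of a jump which is not preceded by a stair. -/
theorem eventually_tracksSegment (hm : MatchConv xn x) (hs : StairConv xn x)
    (hfin : ∀ t, theta x t < ⊤) {t₀ : ℝ≥0} (hd : ¬ ContinuousAt x t₀)
    (hc : ∀ a < t₀, ¬ ConstOn x (Ioo a t₀)) {ε : ℝ} (hε : 0 < ε) :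
    ∃ δ > (0 : ℝ), ∀ s u : ℝ≥0, s < t₀ → t₀ < u → (t₀ : ℝ) < s + δ → (u : ℝ) < t₀ + δ →
      ∀ᶠ n in atTop, TracksSegment (stairMap (xn n)) s u (leftVal x t₀) (x t₀) ε := by
  have hx := x.isCadlag
  have hn : ¬ InStair x t₀ := fun h => hd h.continuousAt
  have hjump : 0 < dist (leftVal x t₀) (x t₀) :=
    dist_pos.2 fun h => hd ((leftVal_eq_iff_continuousAt hx).1 h)
  -- A quarter of the jump keeps values near `x(t₀-)` distinct from values near `x(t₀)`.
  set ε' := min ε (dist (leftVal x t₀) (x t₀) / 4) with hε'def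
  have hε' : 0 < ε' := lt_min hε (by positivity)
  have hεj : ε' ≤ dist (leftVal x t₀) (x t₀) / 4 := min_le_right _ _
  obtain ⟨δ₁, hδ₁, hnear⟩ := exists_near_of_isMatching x t₀ hε'
  have hv : t₀ < t₀ + δ₁.toNNReal := lt_add_of_pos_right _ (Real.toNNReal_pos.2 hδ₁)
  obtain ⟨P, hP, Q, hQ, hPQ⟩ :=
    eventually_prod_iff.1 (eventually_stairFun_near hm hs hfin hn hε' hv)
  obtain ⟨δ₂, hδ₂, hball⟩ := Metric.eventually_nhds_iff.1 hQ
  refine ⟨min δ₁ δ₂, lt_min hδ₁ hδ₂, fun s u hst htu hsδ huδ => ?_⟩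
  have hδ1 : min δ₁ δ₂ ≤ δ₁ := min_le_left _ _
  have hδ2 : min δ₁ δ₂ ≤ δ₂ := min_le_right _ _
  have hcs := hc s hst
  simp only [ConstOn, not_forall] at hcs
  obtain ⟨p, hp, q, hq, hpq⟩ := hcs
  have rst : (s : ℝ) < t₀ := hst
  have rtu : (t₀ : ℝ) < u := htu
  have rsp : (s : ℝ) < p := hp.1
  have rsq : (s : ℝ) < q := hq.1
  have hdist := dist_pos.2 hpq
  -- The times `p`, `q` witness that `x` is not constant on `(s, t₀)`. The matching must be fine
  -- enough to keep their images after `s`, to separate their values, and to keep `lam t₀` before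
  -- `u`.
  set δ₃ := min (min δ₁ (dist (x p) (x q) / 2)) (min (min ((p : ℝ) - s) ((q : ℝ) - s))
    ((u : ℝ) - t₀)) with hδ₃def
  have hδ₃ : 0 < δ₃ := lt_min (lt_min hδ₁ (half_pos hdist))
    (lt_min (lt_min (by linarith) (by linarith)) (by linarith))
  have a1 : δ₃ ≤ δ₁ := (min_le_left _ _).trans (min_le_left _ _)
  have a2 : δ₃ ≤ dist (x p) (x q) / 2 := (min_le_left _ _).trans (min_le_right _ _)
  have a3 : δ₃ ≤ (p : ℝ) - s :=
    (min_le_right _ _).trans ((min_le_left _ _).trans (min_le_left _ _))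
  have a4 : δ₃ ≤ (q : ℝ) - s :=
    (min_le_right _ _).trans ((min_le_left _ _).trans (min_le_right _ _))
  have a5 : δ₃ ≤ (u : ℝ) - t₀ := (min_le_right _ _).trans (min_le_right _ _)
  filter_upwards [hm (t₀ + 1) δ₃ hδ₃, hP] with n ⟨lam, hlam⟩ hPn
  refine TracksSegment.mono ?_ (min_le_left _ _ : ε' ≤ ε)
  set z := xn n with hzdef
  have hz := z.isCadlag
  set b := lam t₀ with hb
  have hbu : b < u := by
    have := abs_lt.1 (hlam.time t₀)
    rw [← NNReal.coe_lt_coe]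
    linarith
  have hsp : s < lam p := by
    have := abs_lt.1 (hlam.time p)
    rw [← NNReal.coe_lt_coe]
    linarith
  have hsq : s < lam q := by
    have := abs_lt.1 (hlam.time q)
    rw [← NNReal.coe_lt_coe]
    linarith
  have hpb : lam p < b := lam.strictMono hp.2
  have hqb : lam q < b := lam.strictMono hq.2
  have hsb : s < b := hsp.trans hpb
  have hwin : ∀ t, s ≤ t → (t : ℝ) < t₀ + δ₁ → |(t : ℝ) - t₀| < δ₁ := by
    intro t h1 h2
    have r1 : (s : ℝ) ≤ t := h1
    rw [abs_lt]
    constructor <;> linarith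
  have hwin' : ∀ t, s ≤ t → t ≤ u → (t : ℝ) < t₀ + δ₁ := by
    intro t h1 h2
    have r2 : (t : ℝ) ≤ u := h2
    linarith
  have hmatch := hlam.mono a1 le_rfl
  have hleft : ∀ t, s ≤ t → t < b → dist (z t) (leftVal x t₀) < ε' := fun t h1 h2 =>
    (hnear _ lam hmatch t (hwin t h1 (hwin' t h1 (h2.le.trans hbu.le)))).1 h2
  have hright : ∀ t, b ≤ t → (t : ℝ) < t₀ + δ₁ → dist (z t) (x t₀) < ε' := fun t h1 h2 =>
    (hnear _ lam hmatch t (hwin t (hsb.le.trans h1) h2)).2 h1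
  have hyright : ∀ t, b ≤ t → t ≤ u → dist (stairFun z t) (x t₀) < ε' := by
    intro t h1 h2
    have r1 : (b : ℝ) ≤ t := h1
    have r2 : (t : ℝ) ≤ u := h2
    have r3 : (s : ℝ) < b := hsb
    refine hPQ hPn (y := t) (hball ?_) fun t' h3 h4 => hright t' (h1.trans h3) ?_
    · rw [NNReal.dist_eq, abs_lt]
      constructor <;> linarith
    · have h4' : ((t' : ℝ≥0) : ℝ) < (t₀ + δ₁.toNNReal : ℝ≥0) := h4
      rwa [NNReal.coe_add, Real.coe_toNNReal _ hδ₁.le] at h4'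
  have hbδ : (b : ℝ) < t₀ + δ₁ := hwin' b hsb.le hbu.le
  -- The values of `z` before `b` and at `b` are separated, so no stair can pass over `b`.
  have hθ : ∀ t, s ≤ t → t < b → theta z t ≤ b := by
    intro t h1 h2
    refine theta_le_of_ne h2.le fun heq => ?_
    have c1 := hleft t h1 h2
    have c2 := hright b le_rfl hbδ
    rw [heq] at c1
    have := dist_triangle_left (leftVal x t₀) (x t₀) (z b)
    linarith
  have hyleft : ∀ t, s ≤ t → theta z t < b → dist (stairFun z t) (leftVal x t₀) < ε' :=
    fun t h1 h2 => stairFun_mem_ball_of_theta_lt hz h2 fun t' h3 h4 => hleft t' (h1.trans h3) h4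
  -- Either a stair of `z` ends at `b`, and `stairFun z` climbs affinely to `z b`, or all earlier
  -- stairs end strictly before `b`, and `stairFun z` stays near `x(t₀-)` until it jumps.
  by_cases hex : ∃ t, s ≤ t ∧ t < b ∧ theta z t = b
  · obtain ⟨t, h1, h2, h3⟩ := hex
    obtain ⟨t', h4, h5⟩ := exists_between h2
    have hconst : ConstOn z (Ioo t b) := by
      have haux : ∀ v ∈ Ioo t b, z v = z t := fun v hv => by
        have hvθ : (v : ℝ≥0∞) < theta z t := by
          rw [h3]
          exact_mod_cast hv.2
        exact eq_of_lt_theta hv.1.le hvθ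
      intro v hv w hw
      rw [haux v hv, haux w hw]
    have hθ' : theta z t' = b :=
      le_antisymm (hθ t' (h1.trans h4.le) h5) (le_theta_of_const hconst ⟨h4, h5⟩)
    have hθf : thetaFin z t' = b := by rw [thetaFin, hθ', ENNReal.toNNReal_coe]
    have hη : eta z t' < t' := (eta_le_of_const hconst ⟨h4, h5⟩).trans_lt h4
    have htθ : (t' : ℝ≥0∞) < theta z t' := by rw [hθ']; exact_mod_cast h5
    have hfin' : theta z t' ≠ ⊤ := by rw [hθ']; exact ENNReal.coe_ne_top
    -- The climbing stair must begin inside the window; otherwise `z` would agree at `lam p` and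
    -- `lam q`.
    have hsη : s < eta z t' := by
      by_contra hle
      rw [not_lt] at hle
      have e1 : z (lam p) = z t' := apply_eq_of_mem_stair hz (hle.trans hsp.le)
        (by rw [hθ']; exact_mod_cast hpb)
      have e2 : z (lam q) = z t' := apply_eq_of_mem_stair hz (hle.trans hsq.le)
        (by rw [hθ']; exact_mod_cast hqb)
      have c1 := hlam.space p (hp.2.le.trans le_self_add)
      have c2 := hlam.space q (hq.2.le.trans le_self_add)
      rw [e1] at c1
      rw [e2] at c2
      have := dist_triangle_left (x p) (x q) (z t')
      linarith
    refine tracksSegment_of_affine (a := eta z t') (b := b) (c := z t') (w := z b) hsη.le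
      (hη.trans h5) hbu.le (fun v hv hv' => ?_) (fun v hv hv' => ?_) (fun v hv hv' => ?_) ?_ ?_
    · rw [← dist_eq_norm]
      exact (hyleft v hv ((theta_le_eta hz hv').trans_lt (by exact_mod_cast hη.trans h5))).le
    · have := stairFun_eq_of_mem_stair hz hη htθ hfin' hv (hv'.trans hθf.ge)
      rwa [hθf] at this
    · rw [← dist_eq_norm]
      exact (hyright v hv hv').le
    · rw [← dist_eq_norm]
      exact (hleft t' (h1.trans h4.le) h5).le
    · rw [← dist_eq_norm]
      exact (hright b le_rfl hbδ).le
  · push Not at hex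
    have hl : ∀ t, s ≤ t → t < b → dist (stairFun z t) (leftVal x t₀) < ε' := fun t h1 h2 =>
      hyleft t h1 (lt_of_le_of_ne (hθ t h1 h2) (hex t h1 h2))
    refine tracksSegment_of_jump hsb hbu.le (fun t h1 h2 => ?_) (fun t h1 h2 => ?_) fun heq => ?_
    · rw [← dist_eq_norm]
      exact (hl t h1 h2).le
    · rw [← dist_eq_norm]
      exact (hyright t h1 h2).le
    · have c1 : leftVal (stairMap z) b ∈ Metric.closedBall (leftVal x t₀) ε' :=
        leftVal_mem_of_isClosed (stairMap z).isCadlag hsb Metric.isClosed_closedBall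
          fun t h1 h2 => (hl t h1.le h2).le
      have c2 : dist (stairMap z b) (x t₀) < ε' := hyright b le_rfl hbu.le
      rw [heq, Metric.mem_closedBall] at c1
      have := dist_triangle_left (leftVal x t₀) (x t₀) (stairMap z b)
      linarith

/-- Tracking for the constant sequence shows that `f(x)` has the same left limit `x(t₀-)` as `x`,
while `f(x)(t₀) = x(t₀)`. -/
theorem not_continuousAt_stairMap (hfin : ∀ t, theta x t < ⊤) {t₀ : ℝ≥0}
    (hd : ¬ ContinuousAt x t₀) (hc : ∀ a < t₀, ¬ ConstOn x (Ioo a t₀)) :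
    ¬ ContinuousAt (stairMap x) t₀ := by
  have hx := x.isCadlag
  have hn : ¬ InStair x t₀ := fun h => hd h.continuousAt
  have h0 : t₀ ≠ 0 := by
    rintro rfl
    exact hd ((leftVal_eq_iff_continuousAt hx).1 (leftVal_zero x))
  intro hcont
  have hne : leftVal x t₀ ≠ x t₀ := fun h => hd ((leftVal_eq_iff_continuousAt hx).1 h)
  have : (𝓝[<] t₀).NeBot := nhdsLT_neBot_of_exists_lt ⟨0, pos_iff_ne_zero.2 h0⟩
  have h1 : Tendsto (stairMap x) (𝓝[<] t₀) (𝓝 (x t₀)) := by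
    have := hcont.tendsto.mono_left (nhdsWithin_le_nhds (s := Iio t₀))
    rwa [show stairMap x t₀ = x t₀ from stairFun_of_not_inStair (hfin t₀) hn] at this
  refine hne (tendsto_nhds_unique (f := stairMap x) (l := 𝓝[<] t₀) ?_ h1)
  rw [Metric.tendsto_nhds]
  intro ε hε
  obtain ⟨δ, hδ, h⟩ := eventually_tracksSegment (matchConv_const x) (stairConv_const x) hfin hd hc
    (half_pos hε)
  obtain ⟨u, hu⟩ : ∃ u : ℝ≥0, t₀ < u ∧ (u : ℝ) < t₀ + δ := by
    refine ⟨t₀ + (δ / 2).toNNReal, lt_add_of_pos_right _ (Real.toNNReal_pos.2 (half_pos hδ)), ?_⟩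
    rw [NNReal.coe_add, Real.coe_toNNReal _ (half_pos hδ).le]
    linarith
  filter_upwards [self_mem_nhdsWithin,
    (eventually_abs_coe_sub_lt t₀ hδ).filter_mono nhdsWithin_le_nhds] with s hs hs'
  have hs'' := abs_lt.1 hs'
  obtain ⟨-, κ, -, hκ, -, -, hnear⟩ := (h s u hs hu.1 (by linarith) hu.2).exists
  have := hnear _ (Or.inl rfl)
  rw [hκ, zero_smul, add_zero, ← dist_eq_norm] at this
  exact this.trans_lt (by linarith)

/-- Near every time, `stairMap x` and `stairMap (xn n)` track a common segment. -/
theorem exists_tracksSegment (hm : MatchConv xn x) (hs : StairConv xn x)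
    (hfin : ∀ t, theta x t < ⊤) (t₀ : ℝ≥0) {ε : ℝ} (hε : 0 < ε) :
    ∃ δ > (0 : ℝ), ∀ s u : ℝ≥0, s < u → s ≤ t₀ → t₀ ≤ u → (t₀ : ℝ) < s + δ → (u : ℝ) < t₀ + δ →
      ContinuousAt (stairMap x) s → ContinuousAt (stairMap x) u →
      ∃ l r, TracksSegment (stairMap x) s u l r ε ∧
        ∀ᶠ n in atTop, TracksSegment (stairMap (xn n)) s u l r ε := by
  by_cases hcase : ¬ ContinuousAt x t₀ ∧ ∀ a < t₀, ¬ ConstOn x (Ioo a t₀)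
  · obtain ⟨hd, hc⟩ := hcase
    obtain ⟨δ₁, hδ₁, h₁⟩ := eventually_tracksSegment hm hs hfin hd hc hε
    obtain ⟨δ₂, hδ₂, h₂⟩ := eventually_tracksSegment (matchConv_const x) (stairConv_const x) hfin
      hd hc hε
    have hy := not_continuousAt_stairMap hfin hd hc
    refine ⟨min δ₁ δ₂, lt_min hδ₁ hδ₂, fun s u hsu hs hu hsδ huδ hsc huc => ?_⟩
    -- The window ends are continuity points of `f(x)`, so neither can be the jump time `t₀`.
    have hs' : s < t₀ := lt_of_le_of_ne hs fun h => hy (h ▸ hsc)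
    have hu' : t₀ < u := lt_of_le_of_ne hu fun h => hy (h ▸ huc)
    have d1 : min δ₁ δ₂ ≤ δ₁ := min_le_left _ _
    have d2 : min δ₁ δ₂ ≤ δ₂ := min_le_right _ _
    exact ⟨_, _, (h₂ s u hs' hu' (by linarith) (by linarith)).exists.choose_spec,
      h₁ s u hs' hu' (by linarith) (by linarith)⟩
  · have key : ∀ yn : ℕ → Cadlag d, MatchConv yn x → StairConv yn x →
        Tendsto (fun p : ℕ × ℝ≥0 => stairFun (yn p.1) p.2) (atTop ×ˢ 𝓝 t₀)
          (𝓝 (stairFun x t₀)) := by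
      intro yn hym hys
      by_cases hc : ContinuousAt x t₀
      · exact tendsto_stairFun_of_continuousAt hym hys hfin hc
      · simp only [hc, not_false_eq_true, true_and, not_forall, not_not] at hcase
        obtain ⟨a, ha, hconst⟩ := hcase
        exact tendsto_stairFun_of_constOn_left hym hys hfin hc ha hconst
    have aux : ∀ yn : ℕ → Cadlag d, MatchConv yn x → StairConv yn x → ∃ δ > (0 : ℝ),
        ∀ s u : ℝ≥0, s < u → (t₀ : ℝ) < s + δ → (u : ℝ) < t₀ + δ →
          ∀ᶠ n in atTop, TracksSegment (stairMap (yn n)) s u (stairFun x t₀) (stairFun x t₀) ε := by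
      intro yn hym hys
      have h1 : ∀ᶠ p : ℕ × ℝ≥0 in atTop ×ˢ 𝓝 t₀,
          dist (stairFun (yn p.1) p.2) (stairFun x t₀) < ε :=
        key yn hym hys (Metric.ball_mem_nhds _ hε)
      obtain ⟨P, hP, Q, hQ, hPQ⟩ := eventually_prod_iff.1 h1
      obtain ⟨δ, hδ, hball⟩ := Metric.eventually_nhds_iff.1 hQ
      refine ⟨δ, hδ, fun s u hsu hsδ huδ => ?_⟩
      filter_upwards [hP] with n hn
      refine tracksSegment_of_near hsu fun t h2 h3 => ?_
      rw [← dist_eq_norm]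
      refine (hPQ hn (y := t) (hball ?_)).le
      have r1 : (s : ℝ) ≤ t := h2
      have r2 : (t : ℝ) ≤ u := h3
      rw [NNReal.dist_eq, abs_lt]
      constructor <;> linarith
    obtain ⟨δ₁, hδ₁, h₁⟩ := aux xn hm hs
    obtain ⟨δ₂, hδ₂, h₂⟩ := aux _ (matchConv_const x) (stairConv_const x)
    refine ⟨min δ₁ δ₂, lt_min hδ₁ hδ₂, fun s u hsu _ _ hsδ huδ _ _ => ?_⟩
    have d1 : min δ₁ δ₂ ≤ δ₁ := min_le_left _ _
    have d2 : min δ₁ δ₂ ≤ δ₂ := min_le_right _ _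
    exact ⟨_, _, (h₂ s u hsu (by linarith) (by linarith)).exists.choose_spec,
      h₁ s u hsu (by linarith) (by linarith)⟩

end Conv

/-! ### Monotone paths in the unit square -/

/-- The points `a` and `b` of the unit square are joined by a nondecreasing path inside `F`. -/
def MonoJoined (F : Set (unitInterval × unitInterval)) (a b : unitInterval × unitInterval) :
    Prop :=
  ∃ γ : Path a b, Monotone γ ∧ ∀ t, γ t ∈ F

theorem MonoJoined.trans {F : Set (unitInterval × unitInterval)}
    {a b c : unitInterval × unitInterval} (h : MonoJoined F a b) (h' : MonoJoined F b c) :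
    MonoJoined F a c := by
  obtain ⟨γ, h1, h2⟩ := h
  obtain ⟨γ', h1', h2'⟩ := h'
  refine ⟨γ.trans γ', fun s t hst => ?_, fun t => ?_⟩
  · have hst' : (s : ℝ) ≤ t := hst
    rw [Path.trans_apply, Path.trans_apply]
    split_ifs with hs ht ht
    · exact h1 (Subtype.mk_le_mk.2 (by linarith))
    · calc _ ≤ γ 1 := h1 unitInterval.le_one'
        _ = γ' 0 := by rw [γ.target, γ'.source]
        _ ≤ _ := h1' unitInterval.nonneg'
    · exact absurd (hst'.trans ht) hs
    · exact h1' (Subtype.mk_le_mk.2 (by linarith))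
  · rw [Path.trans_apply]
    split_ifs
    exacts [h2 _, h2' _]

theorem MonoJoined.source_mem {F : Set (unitInterval × unitInterval)}
    {a b : unitInterval × unitInterval} (h : MonoJoined F a b) : a ∈ F := by
  obtain ⟨γ, -, h2⟩ := h
  simpa using h2 0

theorem MonoJoined.target_mem {F : Set (unitInterval × unitInterval)}
    {a b : unitInterval × unitInterval} (h : MonoJoined F a b) : b ∈ F := by
  obtain ⟨γ, -, h2⟩ := h
  simpa using h2 1

theorem exists_monotone_path {a b : unitInterval} (hab : a ≤ b) :
    ∃ γ : Path a b, Monotone γ := by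
  have hab' : (a : ℝ) ≤ b := hab
  have hmem : ∀ t : unitInterval, (a : ℝ) + t * (b - a) ∈ unitInterval := fun t => by
    have h1 := mul_nonneg t.2.1 (sub_nonneg.2 hab')
    have h2 := mul_le_of_le_one_left (sub_nonneg.2 hab') t.2.2
    exact ⟨by linarith [a.2.1], by linarith [b.2.2]⟩
  refine ⟨⟨⟨fun t => ⟨(a : ℝ) + t * (b - a), hmem t⟩, by fun_prop⟩, by simp, by simp⟩, ?_⟩
  intro s t hst
  have hst' : (s : ℝ) ≤ t := hst
  exact Subtype.mk_le_mk.2 (add_le_add_right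
    (mul_le_mul_of_nonneg_right hst' (sub_nonneg.2 hab')) _)

theorem monoJoined_of_Icc_subset {F : Set (unitInterval × unitInterval)}
    {a b : unitInterval × unitInterval} (hab : a ≤ b) (h : Icc a b ⊆ F) : MonoJoined F a b := by
  obtain ⟨γ₁, h₁⟩ := exists_monotone_path hab.1
  obtain ⟨γ₂, h₂⟩ := exists_monotone_path hab.2
  have hm : Monotone (γ₁.prod γ₂) := fun s t hst => ⟨h₁ hst, h₂ hst⟩
  refine ⟨γ₁.prod γ₂, hm, fun t => h ⟨?_, ?_⟩⟩
  · have := hm (unitInterval.nonneg' : 0 ≤ t)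
    rwa [(γ₁.prod γ₂).source] at this
  · have := hm (unitInterval.le_one' : t ≤ 1)
    rwa [(γ₁.prod γ₂).target] at this

/-! ### Synchronizing two parametric representations -/

section ParamRep

variable {d : ℕ} {T : ℝ≥0} {y z : Cadlag d}

/-- Composition of a parametric representation with a time change of `[0, 1]`. -/
def ParamRep.reparam (a : ParamRep T y) (φ : unitInterval → unitInterval) (hφ : Continuous φ)
    (hm : Monotone φ) (h0 : φ 0 = 0) (h1 : φ 1 = 1) : ParamRep T y where
  toFun := a.toFun ∘ φ
  continuous_toFun := a.continuous_toFun.comp hφ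
  range_eq := by
    have hs : Function.Surjective φ := fun t => mem_range_of_exists_le_of_exists_ge hφ
      ⟨0, by rw [h0]; exact unitInterval.nonneg'⟩ ⟨1, by rw [h1]; exact unitInterval.le_one'⟩
    rw [hs.range_comp, a.range_eq]
  mono := fun s s' h => a.mono _ _ (hm h)

/-- The two coordinates of the path are time changes of `[0, 1]`; composing the representations with
them makes the distance at most `ε` at every common parameter. -/
theorem distSM1_le_of_monoJoined (a : ParamRep T y) (b : ParamRep T z) {ε : ℝ}
    (h : MonoJoined {p | dist (a.toFun p.1) (b.toFun p.2) ≤ ε} (0, 0) (1, 1)) :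
    distSM1 T y z ≤ ENNReal.ofReal ε := by
  obtain ⟨γ, hm, hF⟩ := h
  refine (iInf₂_le (a.reparam (fun t => (γ t).1) (by fun_prop) (fun s t h => (hm h).1)
    (by simp) (by simp)) (b.reparam (fun t => (γ t).2) (by fun_prop) (fun s t h => (hm h).2)
    (by simp) (by simp))).trans ?_
  refine iSup_le fun t => ?_
  rw [edist_dist]
  exact ENNReal.ofReal_le_ofReal (hF t)

theorem ParamRep.exists_eq_of_mem_graphWindow (a : ParamRep T y) {s u : ℝ≥0} (hsu : s ≤ u)
    (hu : u ≤ T) {p : Vec d × ℝ≥0} (hp : p ∈ graphWindow y s u) : ∃ ν, a.toFun ν = p := by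
  have : p ∈ completedGraph T y := by
    rcases hp with rfl | ⟨-, h2, h3⟩
    · exact ⟨hsu.trans hu, right_mem_segment _ _ _⟩
    · exact ⟨h2.trans hu, h3⟩
  rwa [← a.range_eq] at this

theorem ParamRep.mem_completedGraph (a : ParamRep T y) (ν : unitInterval) :
    a.toFun ν ∈ completedGraph T y := by
  rw [← a.range_eq]
  exact mem_range_self ν

theorem graphLE.time_le {p q : Vec d × ℝ≥0} (h : graphLE y p q) : p.2 ≤ q.2 := by
  rcases h with h | h
  exacts [h.le, h.1.le]

/-- `(y s, s)` is the last point of the graph at time `s`. Hence parameters after one that reaches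
it stay in the window starting at `s`. -/
theorem eq_of_graphLE_right {p : Vec d × ℝ≥0} {s : ℝ≥0} (h : graphLE y (y s, s) p)
    (hp : p.2 = s) (hseg : p.1 ∈ segment ℝ (leftVal y p.2) (y p.2)) : p = (y s, s) := by
  obtain ⟨v, t⟩ := p
  dsimp only at hp hseg
  subst hp
  rcases h with h | ⟨-, h⟩
  · exact absurd h (lt_irrefl _)
  · dsimp only at h
    rw [segment_eq_image'] at hseg
    obtain ⟨c, hc, rfl⟩ := hseg
    rw [sub_add_cancel_left, norm_neg, norm_smul, Real.norm_of_nonneg hc.1, norm_sub_rev] at h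
    refine Prod.ext ?_ rfl
    dsimp only
    rcases (norm_nonneg (y t - leftVal y t)).eq_or_lt with h0 | h0
    · have := sub_eq_zero.1 (norm_eq_zero.1 h0.symm)
      rw [this]
      simp
    · have : c = 1 := le_antisymm hc.2 (by
        by_contra hlt
        have := mul_lt_mul_of_pos_right (not_le.1 hlt) h0
        linarith)
      rw [this, one_smul, add_sub_cancel]

theorem ParamRep.mem_graphWindow (a : ParamRep T y) {s u : ℝ≥0} {σ ν : unitInterval}
    (hσ : a.toFun σ = (y s, s)) (hν : σ ≤ ν) (hu : (a.toFun ν).2 ≤ u) :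
    a.toFun ν ∈ graphWindow y s u := by
  have h := a.mono σ ν hν
  have hg := a.mem_completedGraph ν
  rw [hσ] at h
  rcases h.time_le.eq_or_lt with h' | h'
  · exact Or.inl (eq_of_graphLE_right h h'.symm hg.2)
  · exact Or.inr ⟨h', hu, hg.2⟩

theorem time_mem_of_mem_graphWindow {s u : ℝ≥0} (hsu : s ≤ u) {p : Vec d × ℝ≥0}
    (hp : p ∈ graphWindow y s u) : s ≤ p.2 ∧ p.2 ≤ u := by
  rcases hp with rfl | ⟨h1, h2, -⟩
  exacts [⟨le_rfl, hsu⟩, ⟨h1.le, h2⟩]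

/-- If two completed graphs track the same segment between the times `s` and `u`, then their
parametrizations can be synchronized there. -/
theorem exists_monoJoined (a : ParamRep T y) (b : ParamRep T z) {s u : ℝ≥0} (hsu : s < u)
    (hu : u ≤ T) {ε : ℝ} (hε : 0 < ε) (hsuε : (u : ℝ) - s ≤ ε) {l r : Vec d}
    (hy : TracksSegment y s u l r ε) (hz : TracksSegment z s u l r ε) {σ σ' : unitInterval}
    (hσ : a.toFun σ = (y s, s)) (hσ' : b.toFun σ' = (z s, s)) :
    ∃ τ τ', a.toFun τ = (y u, u) ∧ b.toFun τ' = (z u, u) ∧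
      MonoJoined {p | dist (a.toFun p.1) (b.toFun p.2) ≤ 3 * ε} (σ, σ') (τ, τ') := by
  obtain ⟨κ, k1, k2, k3, k4, k5⟩ := hy
  obtain ⟨κ', k1', k2', k3', k4', k5'⟩ := hz
  set F : Set (unitInterval × unitInterval) :=
    {p | dist (a.toFun p.1) (b.toFun p.2) ≤ 3 * ε} with hF
  -- Each of the `k` equal pieces of the segment has length at most `ε`; the two tracking errors
  -- contribute the other `2ε`.
  obtain ⟨k, hk⟩ := exists_nat_gt (‖r - l‖ / ε)
  have hk0 : (0 : ℝ) < k := (div_nonneg (norm_nonneg _) hε.le).trans_lt hk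
  have hkε : 1 / (k : ℝ) * ‖r - l‖ ≤ ε := by
    rw [div_lt_iff₀ hε] at hk
    rw [one_div, inv_mul_le_iff₀ hk0]
    exact hk.le
  have step : ∀ (ν μ ν' μ' : unitInterval) (c c' : ℝ), σ ≤ ν → σ' ≤ ν' →
      a.toFun ν ∈ graphWindow y s u → a.toFun μ ∈ graphWindow y s u →
      b.toFun ν' ∈ graphWindow z s u → b.toFun μ' ∈ graphWindow z s u →
      κ (a.toFun ν) = c → κ (a.toFun μ) = c' → κ' (b.toFun ν') = c → κ' (b.toFun μ') = c' →
      c < c' → c' - c ≤ 1 / k → ν ≤ μ ∧ ν' ≤ μ' ∧ MonoJoined F (ν, ν') (μ, μ') := by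
    intro ν μ ν' μ' c c' hν hν' w1 w2 w1' w2' e1 e2 e1' e2' hlt hle
    have hνμ : ν ≤ μ := by
      by_contra h
      have := k1 _ w2 _ w1 (a.mono _ _ (not_le.1 h).le)
      linarith
    have hνμ' : ν' ≤ μ' := by
      by_contra h
      have := k1' _ w2' _ w1' (b.mono _ _ (not_le.1 h).le)
      linarith
    refine ⟨hνμ, hνμ', monoJoined_of_Icc_subset ⟨hνμ, hνμ'⟩ ?_⟩
    rintro ⟨w, w'⟩ ⟨⟨h1, h1'⟩, ⟨h2, h2'⟩⟩
    dsimp only at h1 h1' h2 h2'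
    have t2 := (time_mem_of_mem_graphWindow hsu.le w2).2
    have t2' := (time_mem_of_mem_graphWindow hsu.le w2').2
    have m := a.mem_graphWindow (u := u) hσ (hν.trans h1) ((a.mono _ _ h2).time_le.trans t2)
    have m' := b.mem_graphWindow (u := u) hσ' (hν'.trans h1') ((b.mono _ _ h2').time_le.trans t2')
    have q1 := k1 _ w1 _ m (a.mono _ _ h1)
    have q2 := k1 _ m _ w2 (a.mono _ _ h2)
    have q1' := k1' _ w1' _ m' (b.mono _ _ h1')
    have q2' := k1' _ m' _ w2' (b.mono _ _ h2')
    rw [e1] at q1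
    rw [e2] at q2
    rw [e1'] at q1'
    rw [e2'] at q2'
    have n := k5 _ m
    have n' := k5' _ m'
    have s1 := time_mem_of_mem_graphWindow hsu.le m
    have s2 := time_mem_of_mem_graphWindow hsu.le m'
    change dist (a.toFun w) (b.toFun w') ≤ 3 * ε
    rw [Prod.dist_eq]
    refine max_le ?_ ?_
    · have hmid : ‖(l + κ (a.toFun w) • (r - l)) - (l + κ' (b.toFun w') • (r - l))‖ ≤ ε := by
        rw [add_sub_add_left_eq_sub, ← sub_smul, norm_smul, Real.norm_eq_abs]
        refine le_trans (mul_le_mul_of_nonneg_right ?_ (norm_nonneg _)) hkε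
        rw [abs_le]
        constructor <;> linarith
      rw [← dist_eq_norm] at n n' hmid
      have d1 := dist_triangle (a.toFun w).1 (l + κ (a.toFun w) • (r - l)) (b.toFun w').1
      have d2 := dist_triangle_right (l + κ (a.toFun w) • (r - l)) (b.toFun w').1
        (l + κ' (b.toFun w') • (r - l))
      linarith
    · have r1 : (s : ℝ) ≤ (a.toFun w).2 := s1.1
      have r2 : ((a.toFun w).2 : ℝ) ≤ u := s1.2
      have r3 : (s : ℝ) ≤ (b.toFun w').2 := s2.1
      have r4 : ((b.toFun w').2 : ℝ) ≤ u := s2.2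
      rw [NNReal.dist_eq, abs_le]
      constructor <;> linarith
  have wσ : a.toFun σ ∈ graphWindow y s u := Or.inl hσ
  have wσ' : b.toFun σ' ∈ graphWindow z s u := Or.inl hσ'
  -- The trivial alternative at `j = 0` avoids checking beforehand that the starting pair lies in
  -- `F`. The last piece is left out so that it can end at the prescribed points at time `u`, not
  -- merely at points with `κ = 1`.
  have chain : ∀ j : ℕ, j < k → ∃ ν ν', σ ≤ ν ∧ σ' ≤ ν' ∧ a.toFun ν ∈ graphWindow y s u ∧
      b.toFun ν' ∈ graphWindow z s u ∧ κ (a.toFun ν) = j / k ∧ κ' (b.toFun ν') = j / k ∧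
      (j = 0 ∧ ν = σ ∧ ν' = σ' ∨ MonoJoined F (σ, σ') (ν, ν')) := by
    intro j
    induction j with
    | zero =>
      intro _
      refine ⟨σ, σ', le_rfl, le_rfl, wσ, wσ', ?_, ?_, Or.inl ⟨rfl, rfl, rfl⟩⟩
      · rw [hσ, k2]
        simp
      · rw [hσ', k2']
        simp
    | succ j ih =>
      intro hj
      obtain ⟨ν, ν', h1, h1', w, w', e, e', hjoin⟩ := ih (by omega)
      have hj' : ((j + 1 : ℕ) : ℝ) < k := by exact_mod_cast hj
      have hc : ((j + 1 : ℕ) : ℝ) / k ∈ Icc (0 : ℝ) 1 :=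
        ⟨by positivity, div_le_one_of_le₀ hj'.le hk0.le⟩
      obtain ⟨p, hp, hpκ⟩ := k4 _ hc
      obtain ⟨p', hp', hpκ'⟩ := k4' _ hc
      obtain ⟨μ, rfl⟩ := a.exists_eq_of_mem_graphWindow hsu.le hu hp
      obtain ⟨μ', rfl⟩ := b.exists_eq_of_mem_graphWindow hsu.le hu hp'
      have hsub : ((j + 1 : ℕ) : ℝ) / k - j / k = 1 / k := by
        push_cast
        ring
      have hpos : 0 < 1 / (k : ℝ) := by positivity
      obtain ⟨g1, g2, g3⟩ := step ν μ ν' μ' _ _ h1 h1' w hp w' hp' e hpκ e' hpκ'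
        (by linarith) hsub.le
      refine ⟨μ, μ', h1.trans g1, h1'.trans g2, hp, hp', hpκ, hpκ', Or.inr ?_⟩
      rcases hjoin with ⟨-, rfl, rfl⟩ | hjoin
      · exact g3
      · exact hjoin.trans g3
  have hk1 : 0 < k := by exact_mod_cast hk0
  obtain ⟨ν, ν', h1, h1', w, w', e, e', hjoin⟩ := chain (k - 1) (by omega)
  have hp : (y u, u) ∈ graphWindow y s u := mem_graphWindow hsu.le le_rfl
  have hp' : (z u, u) ∈ graphWindow z s u := mem_graphWindow hsu.le le_rfl
  obtain ⟨τ, hτ⟩ := a.exists_eq_of_mem_graphWindow hsu.le hu hp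
  obtain ⟨τ', hτ'⟩ := b.exists_eq_of_mem_graphWindow hsu.le hu hp'
  have hsub : 1 - ((k - 1 : ℕ) : ℝ) / k = 1 / k := by
    rw [Nat.cast_sub hk1]
    field_simp
    simp
  have hpos : 0 < 1 / (k : ℝ) := by positivity
  obtain ⟨-, -, g3⟩ := step ν τ ν' τ' _ 1 h1 h1' w (hτ ▸ hp) w' (hτ' ▸ hp') e
    (by rw [hτ, k3]) e' (by rw [hτ', k3']) (by linarith) hsub.le
  refine ⟨τ, τ', hτ, hτ', ?_⟩
  rcases hjoin with ⟨-, rfl, rfl⟩ | hjoin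
  · exact g3
  · exact hjoin.trans g3

theorem ParamRep.apply_zero (a : ParamRep T y) : a.toFun 0 = (y 0, 0) := by
  have hmem : ((y 0, 0) : Vec d × ℝ≥0) ∈ completedGraph T y :=
    ⟨zero_le, right_mem_segment _ _ _⟩
  rw [← a.range_eq] at hmem
  obtain ⟨ν, hν⟩ := hmem
  have h := (a.mono 0 ν unitInterval.nonneg').time_le
  rw [hν] at h
  have h0 : (a.toFun 0).2 = 0 := le_antisymm h zero_le
  have hg := (a.mem_completedGraph 0).2
  rw [h0, leftVal_zero, segment_same] at hg
  exact Prod.ext hg h0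

theorem ParamRep.apply_eq_of_le (a : ParamRep T y) {τ ν : unitInterval}
    (hτ : a.toFun τ = (y T, T)) (h : τ ≤ ν) : a.toFun ν = (y T, T) := by
  have hle := a.mono τ ν h
  have hg := a.mem_completedGraph ν
  rw [hτ] at hle
  exact eq_of_graphLE_right hle (le_antisymm hg.1 hle.time_le) hg.2

end ParamRep

/-! ### Chaining the windows over `[0, T]` -/

section Conv

variable {d : ℕ} {xn : ℕ → Cadlag d} {x : Cadlag d}

/-- The representations are arbitrary and fixed in advance; only their relative speed is adjusted.
The set `S` of continuity times of `f(x)` up to which this can be done for large `n` reaches `T`,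
because a window around `sup S` leads from a point of `S` past the supremum, or to `T`. -/
theorem eventually_distSM1_le (hm : MatchConv xn x) (hs : StairConv xn x)
    (hfin : ∀ t, theta x t < ⊤) {T : ℝ≥0} (hT : 0 < T) (hTc : ContinuousAt (stairMap x) T)
    {ε : ℝ} (hε : 0 < ε) :
    ∀ᶠ n in atTop, distSM1 T (stairMap (xn n)) (stairMap x) ≤ ENNReal.ofReal (3 * ε) := by
  set y := stairMap x with hy
  have a : ∀ n, ParamRep T (stairMap (xn n)) := fun n => (exists_paramRep _ hT).some
  have b : ParamRep T y := (exists_paramRep _ hT).some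
  let F : ℕ → Set (unitInterval × unitInterval) := fun n =>
    {p | dist ((a n).toFun p.1) (b.toFun p.2) ≤ 3 * ε}
  let Reach : ℕ → ℝ≥0 → Prop := fun n t => ∃ τ τ', (a n).toFun τ = (stairMap (xn n) t, t) ∧
    b.toFun τ' = (y t, t) ∧ MonoJoined (F n) (0, 0) (τ, τ')
  have link : ∀ t₀ : ℝ≥0, ∃ δ > (0 : ℝ), ∀ s u : ℝ≥0, s < u → s ≤ t₀ → t₀ ≤ u →
      (t₀ : ℝ) < s + δ → (u : ℝ) < t₀ + δ → ContinuousAt y s → ContinuousAt y u → u ≤ T →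
      ∀ᶠ n in atTop, ∀ σ σ', (a n).toFun σ = (stairMap (xn n) s, s) → b.toFun σ' = (y s, s) →
        ∃ τ τ', (a n).toFun τ = (stairMap (xn n) u, u) ∧ b.toFun τ' = (y u, u) ∧
          MonoJoined (F n) (σ, σ') (τ, τ') := by
    intro t₀
    obtain ⟨δ, hδ, h⟩ := exists_tracksSegment hm hs hfin t₀ hε
    refine ⟨min δ (ε / 2), lt_min hδ (half_pos hε), fun s u hsu h1 h2 h3 h4 hsc huc hu => ?_⟩
    have d1 : min δ (ε / 2) ≤ δ := min_le_left _ _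
    have d2 : min δ (ε / 2) ≤ ε / 2 := min_le_right _ _
    obtain ⟨l, r, hly, hln⟩ := h s u hsu h1 h2 (by linarith) (by linarith) hsc huc
    filter_upwards [hln] with n hn σ σ' hσ hσ'
    exact exists_monoJoined (a n) b hsu hu hε (by linarith) hn hly hσ hσ'
  have hcont0 : ContinuousAt y 0 := (leftVal_eq_iff_continuousAt y.isCadlag).1 (leftVal_zero y)
  have next : ∀ c < T, ∀ δ > (0 : ℝ), ∃ u, c < u ∧ u ≤ T ∧ (u : ℝ) < c + δ ∧
      ContinuousAt y u := by
    intro c hc δ hδ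
    obtain ⟨u, h1, h2, h3⟩ := exists_continuousAt_mem_Ioo y.isCadlag
      (lt_min (lt_add_of_pos_right c (Real.toNNReal_pos.2 hδ)) hc)
    refine ⟨u, h1, (h2.trans_le (min_le_right _ _)).le, ?_, h3⟩
    have : ((u : ℝ≥0) : ℝ) < (c + δ.toNNReal : ℝ≥0) := h2.trans_le (min_le_left _ _)
    rwa [NNReal.coe_add, Real.coe_toNNReal _ hδ.le] at this
  let S : Set ℝ≥0 := {t | t ≤ T ∧ ContinuousAt y t ∧ ∀ᶠ n in atTop, Reach n t}
  have h0S : (0 : ℝ≥0) ∈ S := by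
    refine ⟨zero_le, hcont0, ?_⟩
    obtain ⟨δ, hδ, h⟩ := link 0
    obtain ⟨u, h1, h2, h3, h4⟩ := next 0 hT δ hδ
    -- The first window is used only to learn that the pair of starting points is within `3ε`.
    filter_upwards [h 0 u h1 le_rfl h1.le (by simpa using hδ) h3 hcont0 h4 h2] with n hn
    obtain ⟨τ, τ', -, -, hj⟩ := hn 0 0 (a n).apply_zero b.apply_zero
    refine ⟨0, 0, (a n).apply_zero, b.apply_zero, monoJoined_of_Icc_subset le_rfl ?_⟩
    rw [Icc_self]
    exact singleton_subset_iff.2 hj.source_mem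
  have hbdd : BddAbove S := ⟨T, fun t ht => ht.1⟩
  have hTS : T ∈ S := by
    set c := sSup S with hc
    have hcT : c ≤ T := csSup_le ⟨0, h0S⟩ fun t ht => ht.1
    obtain ⟨δ, hδ, h⟩ := link c
    -- The supremum itself may be a jump time of `f(x)` and lie outside `S`, so the window starts
    -- from a point of `S` near it.
    obtain ⟨s, hsS, hsδ⟩ : ∃ s ∈ S, (c : ℝ) < s + δ := by
      by_contra! hcon
      have h1 : c ≤ c - δ.toNNReal := csSup_le ⟨0, h0S⟩ fun t ht => by
        refine le_tsub_of_add_le_right ?_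
        rw [← NNReal.coe_le_coe, NNReal.coe_add, Real.coe_toNNReal _ hδ.le]
        exact hcon t ht
      have h2 : (0 : ℝ) + δ ≤ c := hcon 0 h0S
      have h3 : 0 < c := by
        rw [← NNReal.coe_pos]
        linarith
      exact absurd h1 (not_le.2 (tsub_lt_self h3 (Real.toNNReal_pos.2 hδ)))
    have hsc : s ≤ c := le_csSup hbdd hsS
    have advance : ∀ u, s < u → c ≤ u → (u : ℝ) < c + δ → ContinuousAt y u → u ≤ T → u ∈ S := by
      intro u h1 h2 h3 h4 h5
      refine ⟨h5, h4, ?_⟩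
      filter_upwards [h s u h1 hsc h2 hsδ h3 hsS.2.1 h4 h5, hsS.2.2] with n hn ⟨σ, σ', e, e', hj⟩
      obtain ⟨τ, τ', f, f', hj'⟩ := hn σ σ' e e'
      exact ⟨τ, τ', f, f', hj.trans hj'⟩
    rcases hcT.eq_or_lt with hcT | hcT
    · rcases (hsc.trans hcT.le).eq_or_lt with hsT | hsT
      · rwa [← hsT]
      · exact advance T hsT hcT.le (by rw [hcT]; linarith) hTc le_rfl
    · obtain ⟨u, h1, h2, h3, h4⟩ := next c hcT δ hδ
      exact absurd (le_csSup hbdd (advance u (hsc.trans_lt h1) h1.le h3 h4 h2)) (not_le.2 h1)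
  filter_upwards [hTS.2.2] with n ⟨τ, τ', e, e', hj⟩
  -- The parameters reaching time `T` may be less than `1`, but both representations are constant
  -- from there on.
  refine distSM1_le_of_monoJoined (a n) b (hj.trans (monoJoined_of_Icc_subset
    ⟨unitInterval.le_one', unitInterval.le_one'⟩ ?_))
  rintro ⟨w, w'⟩ ⟨⟨h1, h1'⟩, -⟩
  have := hj.target_mem
  change dist ((a n).toFun w) (b.toFun w') ≤ 3 * ε
  rwa [(a n).apply_eq_of_le e h1, b.apply_eq_of_le e' h1', ← e, ← e']

end Conv

theorem mainTheorem1 (d : ℕ) (x : Cadlag d) (xn : ℕ → Cadlag d)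
    (hfin : ∀ t : ℝ≥0, theta x t < ⊤)
    (hJ1 : TendstoJ1 xn x)
    (hstair : ∀ t : ℝ≥0, InStair x t →
      ∃ tn : ℕ → ℝ≥0, Tendsto tn atTop (𝓝 t) ∧
        Tendsto (fun n => eta (xn n) (tn n)) atTop (𝓝 (eta x t)) ∧
        Tendsto (fun n => theta (xn n) (tn n)) atTop (𝓝 (theta x t)) ∧
        Tendsto (fun n => ‖xn n (thetaFin (xn n) (tn n)) -
            leftVal (xn n) (thetaFin (xn n) (tn n))‖) atTop
          (𝓝 ‖x (thetaFin x t) - leftVal x (thetaFin x t)‖)) :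
    TendstoSM1 (fun n => stairMap (xn n)) (stairMap x) := by
  intro T hT hTd
  rw [ENNReal.tendsto_nhds_zero]
  intro ε hε
  obtain ⟨η, hη, hηε⟩ : ∃ η : ℝ, 0 < η ∧ ENNReal.ofReal (3 * η) ≤ ε := by
    rcases eq_or_ne ε ⊤ with rfl | h
    · exact ⟨1, one_pos, le_top⟩
    · refine ⟨ε.toReal / 3, by have := ENNReal.toReal_pos hε.ne' h; positivity, ?_⟩
      rw [mul_div_cancel₀ _ three_ne_zero, ENNReal.ofReal_toReal h]
  filter_upwards [eventually_distSM1_le hJ1.matchConv hstair hfin hT (not_not.1 hTd) hη] with n hn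
  exact hn.trans hηε
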